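/- Let $\alpha\in(0,2)$. For $\sigma>0$ let $S\alpha S(\sigma)$ denote the symmetric $\alpha$-stable law on $\mathbb R$ with characteristic function $\theta\mapsto\exp(-\sigma^\alpha|\theta|^\alpha)$. For $k\ge 1$ put $d_k=\big\lfloor 2^{2\alpha k/(2-\alpha)}\big\rfloor$. **The array.** Let $X_k(i)$, $k\ge1$, $0\le i\le 2d_k$, be random variables on a probability space such that for each $k$ the row $(X_k(i))_{0\le i\le 2d_k}$ is i.i.d. with law $S\alpha S(k^{-1/\alpha})$ and is independent of all the earlier rows $(X_j(i))_{1\le j<k,\,0\le i\le 2d_j}$. For each $k\ge 1$ let $2^k=t^{(k)}_0<t^{(k)}_1<\dots<t^{(k)}_{L_k}=2^{k^2}$ be a finite partition with $t^{(k)}_{l+1}-t^{(k)}_l\le 1/d_k$ for all $0\le l<L_k$ (so $L_1=0$). Set $Y_k(j)=X_k(j)\,1_{\{2^k\le|X_k(j)|\le 2^{k^2}\}}$, and for $1\le j\le 2d_k$ let $Z_k(j)=\operatorname{sign}(Y_k(j))\,t^{(k)}_l$ if $t^{(k)}_l\le|Y_k(j)|<t^{(k)}_{l+1}$ for some $0\le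 l<L_k$, and $Z_k(j)=0$ if there is no such $l$. **The system.** Let $(\mathcal X,\mathcal B,m)$ be a standard probability space and let $T:\mathcal X\to\mathcal X$ be measurable, $m$-preserving, ergodic and aperiodic (the set of periodic points is null); $T$ need not be invertible. **Theorem.** 1. There are measurable functions $f_k:\mathcal X\to\mathbb R$, $k\ge1$, such that $(f_k\circ T^{j-1})_{k\ge1,\,1\le j\le 2d_k}$ has the same joint distribution as $(Z_k(j))_{k\ge1,\,1\le j\le 2d_k}$. 2. For every such sequence $(f_k)$, for $m$-almost every $x$ only finitely many of the numbers $f_k(x)-f_k(T^{d_k}x)$, $k\ge 1$, are nonzero, so that the function $f=\sum_{k=1}^\infty\big(f_k-f_k\circ T^{d_k}\big)$ is almost everywhere well defined. With $S_n(f)=\sum_{i=0}^{n-1}f\circ T^i$, as $n\to\infty$, $$\frac{S_n(f)}{n^{1/\alpha}}\ \Rightarrow\ S\alpha S(\sigma)\ \text{ in distribution under } m,\qquad\text{where } \sigma>0,\quad \sigma^\alpha=2\ln\Big(\frac{2}{2-\alpha}\Big).$$ -/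

import Mathlib

open MeasureTheory ProbabilityTheory Filter Topology

namespace StableCLT

noncomputable section

/-- `μ` is the symmetric `α`-stable law with dispersion `σ`: the probability measure on `ℝ` with
characteristic function `θ ↦ exp (-σ^α |θ|^α)`. -/
structure IsSAS (α σ : ℝ) (μ : Measure ℝ) : Prop where
  isProbabilityMeasure : IsProbabilityMeasure μ
  pos : 0 < σ
  charFun_eq : ∀ θ : ℝ, charFun μ θ = ((Real.exp (-(σ ^ α * |θ| ^ α)) : ℝ) : ℂ)

/-- A measurable self-map is aperiodic if almost no point is periodic. -/
def Aperiodic {𝒳 : Type*} [MeasurableSpace 𝒳] (T : 𝒳 → 𝒳) (m : Measure 𝒳) : Prop :=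
  ∀ᵐ x ∂m, x ∉ Function.periodicPts T

/-- The half block length `d_k = ⌊2 ^ (2 α k / (2 - α))⌋`. -/
def blockLen (α : ℝ) (k : ℕ) : ℕ :=
  ⌊(2 : ℝ) ^ (2 * α * (k : ℝ) / (2 - α))⌋₊

/-- The stable triangular array `X_k(i)`, `k ≥ 1`, `0 ≤ i ≤ 2 d_k`: each row `k` is i.i.d. with law
`SαS(k^{-1/α})`, and each row is independent of the collection of all earlier rows. -/
structure IsStableArray {Ω : Type*} [MeasurableSpace Ω] (α : ℝ) (P : Measure Ω)
    (X : ℕ → ℕ → Ω → ℝ) : Prop where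
  measurable : ∀ k i : ℕ, 1 ≤ k → i ≤ 2 * blockLen α k → Measurable (X k i)
  law : ∀ k i : ℕ, 1 ≤ k → i ≤ 2 * blockLen α k →
    IsSAS α ((k : ℝ) ^ (-(1 / α))) (P.map (X k i))
  indep_row : ∀ k : ℕ, 1 ≤ k → iIndepFun (fun i : Fin (2 * blockLen α k + 1) => X k i) P
  indep_earlier : ∀ k : ℕ, 1 ≤ k →
    IndepFun (fun ω (i : Fin (2 * blockLen α k + 1)) => X k i ω)
      (fun ω (p : {p : ℕ × ℕ // 1 ≤ p.1 ∧ p.1 < k ∧ p.2 ≤ 2 * blockLen α p.1}) =>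
        X p.1.1 p.1.2 ω) P

/-- For every `k ≥ 1`, `t k 0 < t k 1 < ⋯ < t k (L k)` is a partition of `[2^k, 2^{k²}]` of mesh at
most `1 / d_k`. (For `k = 1` the interval is the single point `2`, and `L 1 = 0`.) -/
structure IsPartition (α : ℝ) (L : ℕ → ℕ) (t : ℕ → ℕ → ℝ) : Prop where
  first : ∀ k : ℕ, 1 ≤ k → t k 0 = 2 ^ k
  last : ∀ k : ℕ, 1 ≤ k → t k (L k) = 2 ^ (k ^ 2)
  step_pos : ∀ k l : ℕ, 1 ≤ k → l < L k → 0 < t k (l + 1) - t k l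
  step_le : ∀ k l : ℕ, 1 ≤ k → l < L k → t k (l + 1) - t k l ≤ 1 / (blockLen α k : ℝ)

open Classical in
/-- Truncation: `x` if `2^k ≤ |x| ≤ 2^{k²}`, and `0` otherwise. -/
def truncate (k : ℕ) (x : ℝ) : ℝ :=
  if (2 : ℝ) ^ k ≤ |x| ∧ |x| ≤ (2 : ℝ) ^ (k ^ 2) then x else 0

open Classical in
/-- Discretisation: `sign(y) t_l` if `t_l ≤ |y| < t_{l+1}` for some (necessarily unique) `l < N`,
and `0` if there is no such `l`. At most one summand is nonzero. -/
def discretise (N : ℕ) (t : ℕ → ℝ) (y : ℝ) : ℝ :=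
  ∑ l ∈ Finset.range N, if t l ≤ |y| ∧ |y| < t (l + 1) then Real.sign y * t l else 0

/-- The truncated array `Y_k(j)`. -/
def arrayY {Ω : Type*} (X : ℕ → ℕ → Ω → ℝ) (k j : ℕ) (ω : Ω) : ℝ :=
  truncate k (X k j ω)

/-- The truncated and discretised array `Z_k(j)`. -/
def arrayZ {Ω : Type*} (L : ℕ → ℕ) (t : ℕ → ℕ → ℝ) (X : ℕ → ℕ → Ω → ℝ) (k j : ℕ) (ω : Ω) : ℝ :=
  discretise (L k) (t k) (arrayY X k j ω)

/-- The pairs `(k, j)` with `k ≥ 1` and `1 ≤ j ≤ 2 d_k`. -/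
abbrev ArrayIndex (α : ℝ) : Type :=
  {p : ℕ × ℕ // 1 ≤ p.1 ∧ 1 ≤ p.2 ∧ p.2 ≤ 2 * blockLen α p.1}

/-- The functions `f_k`, `k ≥ 1`, embed the array `Z` in the system `(𝒳, m, T)`: the whole array
`(f_k ∘ T^{j-1})`, `k ≥ 1`, `1 ≤ j ≤ 2 d_k`, has the same joint distribution as `(Z_k(j))`. -/
structure IsEmbedding {𝒳 Ω : Type*} [MeasurableSpace 𝒳] [MeasurableSpace Ω] (α : ℝ)
    (m : Measure 𝒳) (T : 𝒳 → 𝒳) (P : Measure Ω) (Z : ℕ → ℕ → Ω → ℝ) (f : ℕ → 𝒳 → ℝ) : Prop where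
  measurable : ∀ k : ℕ, 1 ≤ k → Measurable (f k)
  identDistrib : IdentDistrib
    (fun x (p : ArrayIndex α) => f p.1.1 (T^[p.1.2 - 1] x))
    (fun ω (p : ArrayIndex α) => Z p.1.1 p.1.2 ω) m P

/-- The `k`-th summand `f_k - f_k ∘ T^{d_k}`. -/
def term {𝒳 : Type*} (α : ℝ) (T : 𝒳 → 𝒳) (f : ℕ → 𝒳 → ℝ) (k : ℕ) (x : 𝒳) : ℝ :=
  f k x - f k (T^[blockLen α k] x)

/-- The function `∑_{k ≥ 1} (f_k - f_k ∘ T^{d_k})`. -/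
def cltFun {𝒳 : Type*} (α : ℝ) (T : 𝒳 → 𝒳) (f : ℕ → 𝒳 → ℝ) (x : 𝒳) : ℝ :=
  ∑' k : ℕ, term α T f (k + 1) x

end

end StableCLT

/-!
The array embeds because an aperiodic ergodic system has, for every `N`, a measurable colouring by
`2 N` colours under which the points `x, T x, …, T^(N-1) x` have different colours: it is read off
from the entrance time into a set without short returns (`exists_colouring`). A function with
prescribed independent values along windows of length `N` is then constructed colour by colour. On
each colour finitely many measures, the images under `T^k` of `m` restricted to the events already
determined, have to be split in the same proportions, and Lyapunov's convexity theorem does this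
exactly (`exists_map_eq_smul`). Since all the entries `Z_k(j)` take finitely many values, a new row
can be made independent of the earlier ones, and induction over the rows gives the embedding
(`exists_isEmbedding`). No Rokhlin tower and no invertibility is needed.

For the limit theorem only the joint law of the windows is used. Almost everywhere finiteness is the
Borel-Cantelli lemma, as `m (f_k ≠ 0) = O(2^(-α k) / k)`. At time `n` three kinds of rows occur.

* For `2^k > n^{1/α}` the row is likely to vanish along the whole orbit up to time `n`
  (`measureReal_lateSet_le`).
* For `d_k < n` the sum over `n` steps of `f_k - f_k ∘ T^{d_k}` is the sum over `d_k` steps of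
  `f_k - f_k ∘ T^n`. It is a difference of two variables with the same law and of scale
  `(d_k / k)^{1/α}`; all these rows together are `o(n^{1/α})` because `d_k` grows geometrically
  (`sum_shortRows_le`).
* In the remaining rows the sum consists of `2 n` independent entries with signs, and the truncation
  and discretisation of the stable variables are negligible (`sum_rowError_le`), so that row `k`
  contributes the factor `exp (-2 |θ|^α / k)` to the characteristic function at `θ / n^{1/α}`.

The last range is `((2 - α) / (2 α)) log₂ n ≤ k ≤ (1 / α) log₂ n` up to rounding, and the sum of
`2 / k` over it tends to `2 log (2 / (2 - α))` (`tendsto_sum_one_div`). The errors are collected for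
fixed `n` in `norm_charFun_birkhoffSum_sub_le`, and the truncated moments of a stable law, which
control all of them, are estimated through its characteristic function (`truncMoment_le`), without
knowledge of its tails.
-/

namespace StableCLT

/-! ### Splitting finitely many atomless measures simultaneously -/

section Splitting

variable {X : Type*} [MeasurableSpace X]

/-- If every measurable set can be halved simultaneously for all measures of a family, then some
real function is uniformly distributed on `(0, 1]` under each of them: its binary digits are the
successive halvings. -/
theorem exists_map_eq_smul_volume_of_halving {ι : Type*} (μ : ι → Measure X)
    [∀ i, IsFiniteMeasure (μ i)]
    (h : ∀ S : Set X, MeasurableSet S → ∃ E, MeasurableSet E ∧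
      ∀ i, 2 * (μ i).real (S ∩ E) = (μ i).real S) :
    ∃ g : X → ℝ, Measurable g ∧
      ∀ i, (μ i).map g = μ i Set.univ • (volume : Measure ℝ).restrict (Set.Ioc 0 1) := by
  classical
  have step : ∀ c : {c : X → ℕ // Measurable c}, ∃ c' : {c : X → ℕ // Measurable c},
      (∀ x, c'.1 x = 2 * c.1 x ∨ c'.1 x = 2 * c.1 x + 1) ∧
      ∀ i j, 2 * (μ i).real {x | c'.1 x = 2 * j} = (μ i).real {x | c.1 x = j} ∧
        2 * (μ i).real {x | c'.1 x = 2 * j + 1} = (μ i).real {x | c.1 x = j} := by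
    rintro ⟨c, hc⟩
    have hmeas : ∀ j, MeasurableSet {x | c x = j} := fun j => hc (measurableSet_singleton j)
    choose E hE hE2 using fun j : ℕ => h {x | c x = j} (hmeas j)
    have hF : MeasurableSet (⋃ j, {x | c x = j} ∩ E j) :=
      MeasurableSet.iUnion fun j => (hmeas j).inter (hE j)
    have hmem : ∀ x, x ∈ (⋃ j, {x | c x = j} ∩ E j) ↔ x ∈ E (c x) := by
      intro x; simp
    refine ⟨⟨fun x => if x ∈ (⋃ j, {x | c x = j} ∩ E j) then 2 * c x + 1 else 2 * c x,
      Measurable.ite hF ((measurable_const.mul hc).add_const 1) (measurable_const.mul hc)⟩, ?_, ?_⟩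
    · intro x
      dsimp only
      split_ifs <;> simp
    · intro i j
      have h1 : {x | (if x ∈ (⋃ j, {x | c x = j} ∩ E j) then 2 * c x + 1 else 2 * c x)
          = 2 * j + 1} = {x | c x = j} ∩ E j := by
        ext x
        simp only [Set.mem_ofPred_eq, hmem, Set.mem_inter_iff]
        split_ifs with hx
        · constructor
          · intro h
            have : c x = j := by omega
            subst this; exact ⟨rfl, hx⟩
          · rintro ⟨rfl, -⟩; rfl
        · constructor
          · intro h; omega
          · rintro ⟨rfl, h⟩; exact absurd h hx
      have h0 : {x | (if x ∈ (⋃ j, {x | c x = j} ∩ E j) then 2 * c x + 1 else 2 * c x)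
          = 2 * j} = {x | c x = j} \ E j := by
        ext x
        simp only [Set.mem_ofPred_eq, hmem, Set.mem_sdiff]
        split_ifs with hx
        · constructor
          · intro h; omega
          · rintro ⟨rfl, h⟩; exact absurd hx h
        · constructor
          · intro h
            have : c x = j := by omega
            subst this; exact ⟨rfl, hx⟩
          · rintro ⟨rfl, -⟩; rfl
      have h2 := hE2 j i
      have h3 := measureReal_inter_add_sdiff (μ := μ i) (s := {x | c x = j}) (hE j)
      dsimp only
      rw [h1, h0]
      constructor <;> linarith
  choose next hnext1 hnext2 using step
  let c : ℕ → {c : X → ℕ // Measurable c} :=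
    fun n => Nat.rec ⟨fun _ => 0, measurable_const⟩ (fun _ c => next c) n
  have hc0 : ∀ x, (c 0).1 x = 0 := fun x => rfl
  have hcs : ∀ n, c (n + 1) = next (c n) := fun n => rfl
  have hlt : ∀ n x, (c n).1 x < 2 ^ n := by
    intro n
    induction n with
    | zero => intro x; simp [hc0]
    | succ n ih =>
      intro x
      have := ih x
      rw [hcs, pow_succ]
      rcases hnext1 (c n) x with h | h <;> omega
  have hcell : ∀ n i j, j < 2 ^ n →
      (μ i).real {x | (c n).1 x = j} * 2 ^ n = (μ i).real Set.univ := by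
    intro n i
    induction n with
    | zero =>
      intro j hj
      have : j = 0 := by simpa using hj
      subst this
      simp [hc0]
    | succ n ih =>
      intro j hj
      rw [hcs]
      obtain ⟨l, hl | hl⟩ : ∃ l, j = 2 * l ∨ j = 2 * l + 1 := ⟨j / 2, by omega⟩
      · have hl' : l < 2 ^ n := by rw [pow_succ] at hj; omega
        rw [hl, ← ih l hl', ← (hnext2 (c n) i l).1]; ring
      · have hl' : l < 2 ^ n := by rw [pow_succ] at hj; omega
        rw [hl, ← ih l hl', ← (hnext2 (c n) i l).2]; ring
  have hbelow : ∀ n i k, k ≤ 2 ^ n →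
      (μ i).real {x | (c n).1 x < k} * 2 ^ n = k * (μ i).real Set.univ := by
    intro n i k
    induction k with
    | zero => intro _; simp
    | succ k ih =>
      intro hk
      have : {x | (c n).1 x < k + 1} = {x | (c n).1 x < k} ∪ {x | (c n).1 x = k} := by
        ext x; simp only [Set.mem_ofPred_eq, Set.mem_union]; omega
      rw [this, measureReal_union (s₂ := {x | (c n).1 x = k}) _
        ((c n).2 (measurableSet_singleton k)), add_mul,
        ih (by omega), hcell n i k (by omega)]
      · push_cast; ring
      · rw [Set.disjoint_left]; intro x hx hx'
        simp only [Set.mem_ofPred_eq] at hx hx'; omega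
  let a : ℕ → X → ℝ := fun n x => ((c n).1 x : ℝ) / 2 ^ n
  have hmono : ∀ x, Monotone fun n => a n x := by
    intro x
    refine monotone_nat_of_le_succ fun n => ?_
    simp only [a, hcs]
    rw [div_le_div_iff₀ (by positivity) (by positivity), pow_succ]
    have : (2 * (c n).1 x : ℝ) ≤ ((next (c n)).1 x : ℝ) := by
      rcases hnext1 (c n) x with h | h <;> rw [h] <;> push_cast <;> linarith
    nlinarith [pow_pos (two_pos : (0 : ℝ) < 2) n]
  have hanti : ∀ x, Antitone fun n => a n x + 1 / 2 ^ n := by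
    intro x
    refine antitone_nat_of_succ_le fun n => ?_
    simp only [a, hcs]
    rw [← add_div, ← add_div, div_le_div_iff₀ (by positivity) (by positivity), pow_succ]
    have : ((next (c n)).1 x : ℝ) ≤ (2 * (c n).1 x : ℝ) + 1 := by
      rcases hnext1 (c n) x with h | h <;> rw [h] <;> push_cast <;> linarith
    nlinarith [pow_pos (two_pos : (0 : ℝ) < 2) n]
  have hsum : ∀ x n k, a n x ≤ a k x + 1 / 2 ^ k := by
    intro x n k
    have h1 := hmono x (le_max_left n k)
    have h2 := hanti x (le_max_right n k)
    have h3 : (0 : ℝ) < 1 / 2 ^ (max n k) := by positivity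
    simp only at h1 h2
    linarith
  have hbdd : ∀ x, BddAbove (Set.range fun n => a n x) :=
    fun x => ⟨a 0 x + 1 / 2 ^ 0, by rintro _ ⟨n, rfl⟩; exact hsum x n 0⟩
  let g : X → ℝ := fun x => ⨆ n, a n x
  have hg1 : ∀ x n, a n x ≤ g x := fun x n => le_ciSup (hbdd x) n
  have hg2 : ∀ x n, g x ≤ a n x + 1 / 2 ^ n := fun x n => ciSup_le fun k => hsum x k n
  have ha : ∀ n, Measurable (a n) := fun n =>
    ((measurable_from_nat (f := fun j : ℕ => (j : ℝ))).comp (c n).2).div_const _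
  have hgm : Measurable g := Measurable.iSup ha
  refine ⟨g, hgm, fun i => ?_⟩
  have hg0 : ∀ x, 0 ≤ g x := fun x => by
    have := hg1 x 0; simp only [a, hc0] at this; simpa using this
  have hgle : ∀ x, g x ≤ 1 := fun x => by
    have := hg2 x 0; simp only [a, hc0] at this; simpa using this
  set M := (μ i).real Set.univ with hM
  have hM0 : 0 ≤ M := measureReal_nonneg
  have hlim : Tendsto (fun n : ℕ => (1 / 2 ^ n : ℝ)) atTop (𝓝 0) := by
    simpa [one_div, inv_pow] using
      tendsto_pow_atTop_nhds_zero_of_lt_one (by norm_num : (0 : ℝ) ≤ 1 / 2) (by norm_num)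
  have hkey : ∀ t : ℝ, 0 ≤ t → t < 1 → (μ i).real {x | g x ≤ t} = t * M := by
    intro t ht0 ht1
    have upper : ∀ n : ℕ, (μ i).real {x | g x ≤ t} ≤ (t + 1 / 2 ^ n) * M := by
      intro n
      have hp : (0 : ℝ) < 2 ^ n := by positivity
      have hfl : (⌊t * 2 ^ n⌋₊ : ℝ) ≤ t * 2 ^ n := Nat.floor_le (by positivity)
      have hk : ⌊t * 2 ^ n⌋₊ + 1 ≤ 2 ^ n := by
        have : (⌊t * 2 ^ n⌋₊ : ℝ) < 2 ^ n := by nlinarith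
        exact_mod_cast this
      have hsub : {x | g x ≤ t} ⊆ {x | (c n).1 x < ⌊t * 2 ^ n⌋₊ + 1} := by
        intro x hx
        have h1 : a n x ≤ t := (hg1 x n).trans hx
        rw [div_le_iff₀ hp] at h1
        exact Nat.lt_succ_of_le (Nat.le_floor h1)
      have h2 := measureReal_mono (μ := μ i) hsub
      have h3 := hbelow n i _ hk
      have h4 : (μ i).real {x | g x ≤ t} * 2 ^ n ≤ (t * 2 ^ n + 1) * M := by
        calc _ ≤ _ := mul_le_mul_of_nonneg_right h2 hp.le
          _ = _ := h3
          _ ≤ _ := by push_cast; gcongr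
      have : (t + 1 / 2 ^ n) * M = ((t * 2 ^ n + 1) * M) / 2 ^ n := by field_simp
      rw [this, le_div_iff₀ hp]; exact h4
    have lower : ∀ n : ℕ, (t - 1 / 2 ^ n) * M ≤ (μ i).real {x | g x ≤ t} := by
      intro n
      have hp : (0 : ℝ) < 2 ^ n := by positivity
      have hfl : t * 2 ^ n < (⌊t * 2 ^ n⌋₊ : ℝ) + 1 := Nat.lt_floor_add_one _
      have hfl' : (⌊t * 2 ^ n⌋₊ : ℝ) ≤ t * 2 ^ n := Nat.floor_le (by positivity)
      have hk : ⌊t * 2 ^ n⌋₊ ≤ 2 ^ n := by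
        have : (⌊t * 2 ^ n⌋₊ : ℝ) ≤ 2 ^ n := by nlinarith
        exact_mod_cast this
      have hsub : {x | (c n).1 x < ⌊t * 2 ^ n⌋₊} ⊆ {x | g x ≤ t} := by
        intro x hx
        have h1 : ((c n).1 x : ℝ) + 1 ≤ ⌊t * 2 ^ n⌋₊ := by
          exact_mod_cast Nat.succ_le_of_lt hx
        have h2 := hg2 x n
        have h3 : a n x + 1 / 2 ^ n ≤ t := by
          simp only [a]; rw [← add_div, div_le_iff₀ hp]; linarith
        exact h2.trans h3
      have h2 := measureReal_mono (μ := μ i) hsub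
      have h3 := hbelow n i _ hk
      have h4 : (t * 2 ^ n - 1) * M ≤ (μ i).real {x | g x ≤ t} * 2 ^ n := by
        calc _ ≤ (⌊t * 2 ^ n⌋₊ : ℝ) * M := by gcongr; linarith
          _ = _ := h3.symm
          _ ≤ _ := mul_le_mul_of_nonneg_right h2 hp.le
      have : (t - 1 / 2 ^ n) * M = ((t * 2 ^ n - 1) * M) / 2 ^ n := by field_simp
      rw [this, div_le_iff₀ hp]; exact h4
    apply le_antisymm
    · have h : Tendsto (fun n : ℕ => (t + 1 / 2 ^ n) * M) atTop (𝓝 (t * M)) := by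
        simpa using (tendsto_const_nhds.add hlim).mul_const M
      exact ge_of_tendsto' h upper
    · have h : Tendsto (fun n : ℕ => (t - 1 / 2 ^ n) * M) atTop (𝓝 (t * M)) := by
        simpa using (tendsto_const_nhds.sub hlim).mul_const M
      exact le_of_tendsto' h lower
  refine Measure.ext_of_Iic _ _ fun t => ?_
  rw [Measure.map_apply hgm measurableSet_Iic, Measure.smul_apply,
    Measure.restrict_apply measurableSet_Iic, smul_eq_mul]
  have hpre : g ⁻¹' Set.Iic t = {x | g x ≤ t} := rfl
  rw [hpre]
  rcases lt_or_ge t 0 with ht | ht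
  · have h1 : {x | g x ≤ t} = ∅ := by
      ext x; simp only [Set.mem_ofPred_eq, Set.mem_empty_iff_false, iff_false, not_le]
      exact ht.trans_le (hg0 x)
    have h2 : Set.Iic t ∩ Set.Ioc (0 : ℝ) 1 = ∅ := by
      ext x; simp only [Set.mem_inter_iff, Set.mem_Iic, Set.mem_Ioc, Set.mem_empty_iff_false]
      constructor
      · rintro ⟨h1, h2, h3⟩; linarith
      · exact False.elim
    rw [h1, h2]; simp
  rcases lt_or_ge t 1 with ht1 | ht1
  · have h2 : Set.Iic t ∩ Set.Ioc (0 : ℝ) 1 = Set.Ioc 0 t := by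
      ext x; simp only [Set.mem_inter_iff, Set.mem_Iic, Set.mem_Ioc]
      constructor
      · rintro ⟨h1, h2, h3⟩; exact ⟨h2, h1⟩
      · rintro ⟨h1, h2⟩; exact ⟨h2, h1, h2.trans ht1.le⟩
    rw [h2, Real.volume_Ioc, sub_zero, ← ofReal_measureReal (measure_ne_top (μ i) Set.univ),
      ← ENNReal.ofReal_mul hM0, mul_comm, ← hkey t ht ht1, ofReal_measureReal]
  · have h1 : {x | g x ≤ t} = Set.univ := by
      ext x; simp only [Set.mem_ofPred_eq, Set.mem_univ, iff_true]; exact (hgle x).trans ht1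
    have h2 : Set.Iic t ∩ Set.Ioc (0 : ℝ) 1 = Set.Ioc 0 1 := by
      ext x; simp only [Set.mem_inter_iff, Set.mem_Iic, Set.mem_Ioc]
      constructor
      · rintro ⟨h1, h2⟩; exact h2
      · rintro ⟨h1, h2⟩; exact ⟨h2.trans ht1, h1, h2⟩
    rw [h1, h2]; simp

/-- Continuity of the distribution function: an atomless finite measure on the line has a half-line
carrying exactly half of the mass. -/
theorem exists_half_Iic (ν : Measure ℝ) [IsFiniteMeasure ν] [NullSingletonClass ν] :
    ∃ t : ℝ, 2 * ν.real (Set.Iic t) = ν.real Set.univ := by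
  rcases eq_or_lt_of_le (measureReal_nonneg (μ := ν) (s := Set.univ)) with h0 | h0
  · refine ⟨0, ?_⟩
    have := measureReal_mono (μ := ν) (Set.subset_univ (Set.Iic (0 : ℝ)))
    have h2 := measureReal_nonneg (μ := ν) (s := Set.Iic (0 : ℝ))
    linarith
  have hF : Continuous fun b : ℝ => ν.real (Set.Iic b) := by
    have h1 : Continuous fun b : ℝ => ∫ _ in (0 : ℝ)..b, (1 : ℝ) ∂ν :=
      intervalIntegral.continuous_primitive
        (fun a b => intervalIntegrable_const) 0
    have h2 : ∀ b : ℝ, ν.real (Set.Iic b) =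
        (∫ _ in (0 : ℝ)..b, (1 : ℝ) ∂ν) + ν.real (Set.Iic 0) := by
      intro b
      have := intervalIntegral.integral_Iic_sub_Iic (μ := ν) (f := fun _ : ℝ => (1 : ℝ)) (a := 0)
        (b := b) (integrable_const _).integrableOn (integrable_const _).integrableOn
      rw [← this, setIntegral_const, setIntegral_const, smul_eq_mul, smul_eq_mul]
      ring
    have h3 := h1.add_const (ν.real (Set.Iic 0))
    exact h3.congr fun b => (h2 b).symm
  have htop : Tendsto (fun b : ℝ => ν.real (Set.Iic b)) atTop (𝓝 (ν.real Set.univ)) :=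
    (ENNReal.tendsto_toReal (measure_ne_top _ _)).comp (tendsto_measure_Iic_atTop ν)
  have hbot : Tendsto (fun b : ℝ => ν.real (Set.Iic b)) atBot (𝓝 0) := by
    have h1 := (ENNReal.tendsto_toReal (measure_ne_top _ _)).comp (tendsto_measure_iInter_atBot
      (μ := ν) (s := fun b : ℝ => Set.Iic b) (fun b => measurableSet_Iic.nullMeasurableSet)
      (fun a b h => Set.Iic_subset_Iic.2 h) ⟨0, measure_ne_top _ _⟩)
    have h2 : (⋂ b : ℝ, Set.Iic b) = ∅ := by
      refine Set.eq_empty_of_forall_notMem fun x hx => ?_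
      have h3 : x ≤ x - 1 := Set.mem_iInter.1 hx (x - 1)
      linarith
    rw [h2, measure_empty] at h1
    exact h1
  obtain ⟨b, hb⟩ := ((tendsto_order.1 htop).1 (ν.real Set.univ / 2) (by linarith)).exists
  obtain ⟨a, ha⟩ := ((tendsto_order.1 hbot).2 (ν.real Set.univ / 2) (by linarith)).exists
  obtain ⟨t, ht⟩ := mem_range_of_exists_le_of_exists_ge hF ⟨a, ha.le⟩ ⟨b, hb.le⟩
  exact ⟨t, by simp only at ht; linarith⟩

/-- Lyapunov's theorem in the form of a simultaneous halving, by induction on the number of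
measures. A function uniformly distributed under the previous measures gives the sliding window
`{t < g ≤ t + 1/2}`, which halves all of them, and the intermediate value theorem places the window
so that it halves the next measure as well. -/
theorem exists_half [StandardBorelSpace X] (n : ℕ) : ∀ (μ : ℕ → Measure X)
    (_ : ∀ i, IsFiniteMeasure (μ i)) (_ : NullSingletonClass (μ 0)) (_ : ∀ i, μ i ≪ μ 0),
    ∃ E, MeasurableSet E ∧ ∀ i ≤ n, 2 * (μ i).real E = (μ i).real Set.univ := by
  induction n with
  | zero =>
    intro μ hfin hns _
    have he := measurableEmbedding_embeddingReal X
    have : NullSingletonClass ((μ 0).map (embeddingReal X)) := by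
      refine ⟨fun t => ?_⟩
      rw [he.map_apply]
      exact (Set.subsingleton_singleton.preimage he.injective).measure_zero _
    obtain ⟨t, ht⟩ := exists_half_Iic ((μ 0).map (embeddingReal X))
    refine ⟨embeddingReal X ⁻¹' Set.Iic t, he.measurable measurableSet_Iic, fun i hi => ?_⟩
    obtain rfl : i = 0 := by omega
    simpa [measureReal_def, he.map_apply] using ht
  | succ n ih =>
    intro μ hfin hns hac
    obtain ⟨g, hgm, hg⟩ := exists_map_eq_smul_volume_of_halving (fun i => μ (min i n)) (by
      intro S hS
      have : NullSingletonClass ((μ 0).restrict S) := inferInstance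
      obtain ⟨E, hE, h⟩ := ih (fun i => (μ (min i n)).restrict S) (fun i => inferInstance)
        (by simpa using this) (fun i => by simpa using (hac (min i n)).restrict S)
      refine ⟨E ∩ S, hE.inter hS, fun i => ?_⟩
      have := h (min i n) (min_le_right _ _)
      simp only [min_assoc, min_self] at this
      rw [measureReal_restrict_apply hE, measureReal_restrict_apply_univ] at this
      rw [← this, ← Set.inter_assoc, Set.inter_comm S E, Set.inter_assoc, Set.inter_self])
    have hg' : ∀ i ≤ n, (μ i).map g
        = μ i Set.univ • (volume : Measure ℝ).restrict (Set.Ioc 0 1) := by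
      intro i hi; simpa [min_eq_left hi] using hg i
    set ν := (μ (n + 1)).map g with hν
    have hνac : ν ≪ (μ 0).map g := (hac (n + 1)).map hgm
    have hνac' : ν ≪ (volume : Measure ℝ).restrict (Set.Ioc 0 1) := by
      refine hνac.trans ?_
      rw [hg' 0 (Nat.zero_le _)]
      exact Measure.smul_absolutelyContinuous
    have : NullSingletonClass ν := ⟨fun t => hνac' (measure_singleton t)⟩
    have hνcompl : ν (Set.Ioc 0 1)ᶜ = 0 :=
      hνac' (by rw [Measure.restrict_apply measurableSet_Ioc.compl]; simp)
    have hνuniv : ν.real (Set.Ioc 0 1) = ν.real Set.univ := by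
      have h1 := measureReal_add_measureReal_compl (μ := ν)
        (measurableSet_Ioc (a := (0 : ℝ)) (b := 1))
      rw [measureReal_def ν (Set.Ioc 0 1)ᶜ, hνcompl] at h1
      simpa using h1
    have hcont : Continuous fun b : ℝ => ∫ _ in (0 : ℝ)..b, (1 : ℝ) ∂ν :=
      intervalIntegral.continuous_primitive (fun a b => intervalIntegrable_const) 0
    have hint : ∀ a b : ℝ, a ≤ b →
        (∫ _ in (0 : ℝ)..b, (1 : ℝ) ∂ν) - ∫ _ in (0 : ℝ)..a, (1 : ℝ) ∂ν = ν.real (Set.Ioc a b) := by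
      intro a b hab
      rw [intervalIntegral.integral_interval_sub_left intervalIntegrable_const
        intervalIntegrable_const, intervalIntegral.integral_of_le hab, setIntegral_const]
      simp
    obtain ⟨t, ht, htE⟩ : ∃ t ∈ Set.Icc (0 : ℝ) (1 / 2),
        ν.real (Set.Ioc t (t + 1 / 2)) = ν.real Set.univ / 2 := by
      let h : ℝ → ℝ := fun t =>
        (∫ _ in (0 : ℝ)..(t + 1 / 2), (1 : ℝ) ∂ν) - ∫ _ in (0 : ℝ)..t, (1 : ℝ) ∂ν
      have hh : Continuous h := (hcont.comp (continuous_id.add_const (1 / 2))).sub hcont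
      have hhv : ∀ t, h t = ν.real (Set.Ioc t (t + 1 / 2)) := fun t => hint t _ (by linarith)
      have hsum : h 0 + h (1 / 2) = ν.real Set.univ := by
        rw [← hνuniv, ← hint 0 1 zero_le_one]
        simp only [h]; norm_num
      have hmem : ν.real Set.univ / 2 ∈ h '' Set.uIcc 0 (1 / 2) := by
        refine intermediate_value_uIcc hh.continuousOn ?_
        rcases le_total (h 0) (h (1 / 2)) with hle | hle
        · rw [Set.uIcc_of_le hle]; constructor <;> linarith
        · rw [Set.uIcc_of_ge hle]; constructor <;> linarith
      rw [Set.uIcc_of_le (by norm_num)] at hmem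
      obtain ⟨t, ht, hte⟩ := hmem
      exact ⟨t, ht, by rw [← hhv, hte]⟩
    refine ⟨g ⁻¹' Set.Ioc t (t + 1 / 2), hgm measurableSet_Ioc, fun i hi => ?_⟩
    have hpre : ∀ j, (μ j).real (g ⁻¹' Set.Ioc t (t + 1 / 2))
        = ((μ j).map g).real (Set.Ioc t (t + 1 / 2)) := fun j => by
      rw [measureReal_def, measureReal_def, Measure.map_apply hgm measurableSet_Ioc]
    rw [hpre]
    rcases Nat.lt_or_ge n i with hni | hni
    · obtain rfl : i = n + 1 := by omega
      rw [← hν, htE, hν, measureReal_def _ Set.univ, Measure.map_apply hgm MeasurableSet.univ,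
        Set.preimage_univ, ← measureReal_def]
      ring
    · have hsub : Set.Ioc t (t + 1 / 2) ∩ Set.Ioc 0 1 = Set.Ioc t (t + 1 / 2) := by
        refine Set.inter_eq_left.2 (Set.Ioc_subset_Ioc ht.1 ?_)
        linarith [ht.2]
      rw [hg' i hni, measureReal_def, Measure.smul_apply, Measure.restrict_apply measurableSet_Ioc,
        hsub, Real.volume_Ioc, smul_eq_mul, ENNReal.toReal_mul, ← measureReal_def,
        ENNReal.toReal_ofReal (by linarith)]
      ring

/-- **Lyapunov's convexity theorem**, splitting form: finitely many finite measures that are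
absolutely continuous with respect to an atomless one can be split simultaneously and exactly
according to any prescribed law `q`. -/
theorem exists_map_eq_smul [StandardBorelSpace X] (m : Measure X) [IsFiniteMeasure m]
    [NullSingletonClass m] {ι : Type*} [Finite ι] (μ : ι → Measure X)
    (hfin : ∀ i, IsFiniteMeasure (μ i)) (hac : ∀ i, μ i ≪ m)
    {A : Type*} [MeasurableSpace A] [StandardBorelSpace A] (q : Measure A)
    [IsProbabilityMeasure q] :
    ∃ U : X → A, Measurable U ∧ ∀ i, (μ i).map U = μ i Set.univ • q := by
  classical
  obtain ⟨n, ⟨e⟩⟩ := Finite.exists_equiv_fin ι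
  let μ' : ℕ → Measure X := fun k => if h : k ≠ 0 ∧ k - 1 < n then μ (e.symm ⟨k - 1, h.2⟩) else m
  have hμ0 : μ' 0 = m := by simp [μ']
  have hμ' : ∀ i, μ' ((e i : ℕ) + 1) = μ i := by
    intro i; simp [μ']
  have hfin' : ∀ k, IsFiniteMeasure (μ' k) := by
    intro k; simp only [μ']; split_ifs <;> infer_instance
  have hac' : ∀ k, μ' k ≪ m := by
    intro k; simp only [μ']; split_ifs
    · exact hac _
    · exact Measure.AbsolutelyContinuous.rfl
  obtain ⟨g, hgm, hg⟩ := exists_map_eq_smul_volume_of_halving (fun i => μ i) (by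
    intro S hS
    obtain ⟨E, hE, h⟩ := exists_half n (fun i => (μ' i).restrict S) (fun i => inferInstance)
      (by rw [hμ0]; infer_instance) (fun i => by rw [hμ0]; exact (hac' i).restrict S)
    refine ⟨E ∩ S, hE.inter hS, fun i => ?_⟩
    have := h ((e i : ℕ) + 1) (e i).2
    simp only [hμ'] at this
    rw [measureReal_restrict_apply hE, measureReal_restrict_apply_univ] at this
    rw [← this, ← Set.inter_assoc, Set.inter_comm S E, Set.inter_assoc, Set.inter_self])
  have : Nonempty A := q.nonempty_of_neZero
  obtain ⟨F, hFm, hF⟩ := Measure.exists_measurable_map_eq q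
  have hproj : Measurable (Set.projIcc (0 : ℝ) 1 zero_le_one) := continuous_projIcc.measurable
  have hvol : ((volume : Measure ℝ).restrict (Set.Ioc 0 1)).map (Set.projIcc (0 : ℝ) 1 zero_le_one)
      = (volume : Measure unitInterval) := by
    have h1 : (volume : Measure ℝ).restrict (Set.Icc 0 1)
        = (volume : Measure unitInterval).map Subtype.val :=
      (map_comap_subtype_coe measurableSet_Icc _).symm
    rw [Measure.restrict_congr_set Ioc_ae_eq_Icc, h1, Measure.map_map hproj measurable_subtype_coe]
    have h2 : Set.projIcc (0 : ℝ) 1 zero_le_one ∘ Subtype.val = id := by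
      ext x; simp
    rw [h2, Measure.map_id]
  refine ⟨F ∘ Set.projIcc (0 : ℝ) 1 zero_le_one ∘ g, hFm.comp (hproj.comp hgm), fun i => ?_⟩
  rw [← Measure.map_map hFm (hproj.comp hgm), ← Measure.map_map hproj hgm, hg i,
    Measure.map_smul, hvol, Measure.map_smul, hF]

end Splitting

/-! ### Proper colourings of orbit windows -/

section Colouring

/-- In an ergodic system almost every point enters a given set of positive measure. -/
theorem ae_exists_iterate_mem {X : Type*} [MeasurableSpace X] {m : Measure X}
    [IsProbabilityMeasure m] {T : X → X} (hT : Ergodic T m) {S : Set X} (hS : MeasurableSet S)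
    (hS0 : m S ≠ 0) : ∀ᵐ x ∂m, ∃ n : ℕ, T^[n] x ∈ S := by
  let G : Set X := ⋃ n : ℕ, T^[n] ⁻¹' S
  have hG : MeasurableSet G :=
    MeasurableSet.iUnion fun n => (hT.measurable.iterate n) hS
  have hsub : T ⁻¹' G ⊆ G := by
    intro x hx
    obtain ⟨n, hn⟩ := Set.mem_iUnion.1 hx
    exact Set.mem_iUnion.2 ⟨n + 1, hn⟩
  rcases hT.ae_empty_or_univ_of_preimage_ae_le hG.nullMeasurableSet
    (Filter.Eventually.of_forall hsub) with h | h
  · exfalso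
    apply hS0
    refine measure_mono_null (t := G) ?_ (by rw [measure_congr h, measure_empty])
    intro x hx
    exact Set.mem_iUnion.2 ⟨0, hx⟩
  · filter_upwards [h.mem_iff] with x hx
    have := hx.2 (Set.mem_univ x)
    simpa [G] using this

variable {X : Type*} [MeasurableSpace X] [StandardBorelSpace X] {m : Measure X}
  [IsProbabilityMeasure m] {T : X → X}

/-- By Poincaré recurrence an atom would be a periodic point. -/
theorem nullSingletonClass_of_aperiodic (hT : MeasurePreserving T m m) (hap : Aperiodic T m) :
    NullSingletonClass m := by
  refine ⟨fun x => ?_⟩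
  by_contra hx
  obtain ⟨y, hy, n, hn, hyn⟩ := hT.conservative.exists_mem_iterate_mem
    (measurableSet_singleton x).nullMeasurableSet hx
  obtain rfl : y = x := hy
  have hper : y ∈ Function.periodicPts T :=
    Function.mk_mem_periodicPts (Nat.pos_of_ne_zero hn) hyn
  refine hx (measure_mono_null ?_ hap)
  rintro z rfl
  simpa using hper

/-- An aperiodic system has a set of positive measure none of whose points returns within `N`
steps. -/
theorem exists_no_return (hT : Measurable T) (hap : Aperiodic T m) (N : ℕ) :
    ∃ S, MeasurableSet S ∧ m S ≠ 0 ∧ ∀ k, 1 ≤ k → k ≤ N → ∀ x ∈ S, T^[k] x ∉ S := by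
  induction N with
  | zero => exact ⟨Set.univ, MeasurableSet.univ, by simp, fun k h1 h2 => by omega⟩
  | succ N ih =>
    obtain ⟨S, hS, hS0, hSr⟩ := ih
    let e := embeddingReal X
    have he : Measurable e := measurable_embeddingReal X
    have hek : Measurable fun x => e (T^[N + 1] x) := he.comp (hT.iterate _)
    -- A rational separates `x` from `T^(N+1) x`, in one of the two orders.
    let B : ℚ → Set X := fun q => S ∩ {x | e x < q ∧ (q : ℝ) < e (T^[N + 1] x)}
    let B' : ℚ → Set X := fun q => S ∩ {x | (q : ℝ) < e x ∧ e (T^[N + 1] x) < q}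
    have hB : ∀ q, MeasurableSet (B q) := fun q => hS.inter
      ((measurableSet_lt he measurable_const).inter (measurableSet_lt measurable_const hek))
    have hB' : ∀ q, MeasurableSet (B' q) := fun q => hS.inter
      ((measurableSet_lt measurable_const he).inter (measurableSet_lt hek measurable_const))
    have hret : ∀ C : Set X, C ⊆ S → (∀ x ∈ C, T^[N + 1] x ∉ C) →
        ∀ k, 1 ≤ k → k ≤ N + 1 → ∀ x ∈ C, T^[k] x ∉ C := by
      intro C hCS hC k h1 h2 x hx
      rcases Nat.lt_or_ge N k with h | h
      · obtain rfl : k = N + 1 := by omega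
        exact hC x hx
      · exact fun h' => hSr k h1 h x (hCS hx) (hCS h')
    by_contra hcon
    push Not at hcon
    have h0 : ∀ q, m (B q) = 0 := by
      intro q
      by_contra hq
      obtain ⟨k, h1, h2, x, hx, hx'⟩ := hcon (B q) (hB q) hq
      exact hret (B q) Set.inter_subset_left
        (fun x hx hx' => lt_asymm hx.2.2 hx'.2.1) k h1 h2 x hx hx'
    have h0' : ∀ q, m (B' q) = 0 := by
      intro q
      by_contra hq
      obtain ⟨k, h1, h2, x, hx, hx'⟩ := hcon (B' q) (hB' q) hq
      exact hret (B' q) Set.inter_subset_left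
        (fun x hx hx' => lt_asymm hx.2.2 hx'.2.1) k h1 h2 x hx hx'
    apply hS0
    refine measure_mono_null (t := ((⋃ q, B q) ∪ ⋃ q, B' q) ∪ {x | ¬ x ∉ Function.periodicPts T})
      ?_ (measure_union_null (measure_union_null (measure_iUnion_null h0)
        (measure_iUnion_null h0')) hap)
    intro x hx
    by_cases hp : x ∈ Function.periodicPts T
    · right; simpa using hp
    · left
      have hne : e x ≠ e (T^[N + 1] x) := by
        intro h
        have h2 := (measurableEmbedding_embeddingReal X).injective h
        exact hp (Function.mk_mem_periodicPts (Nat.succ_pos N) h2.symm)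
      rcases lt_or_gt_of_ne hne with h | h
      · obtain ⟨q, hq1, hq2⟩ := exists_rat_btwn h
        exact Or.inl (Set.mem_iUnion.2 ⟨q, hx, hq1, hq2⟩)
      · obtain ⟨q, hq1, hq2⟩ := exists_rat_btwn h
        exact Or.inr (Set.mem_iUnion.2 ⟨q, hx, hq2, hq1⟩)

/-- An ergodic aperiodic map has a measurable colouring by `2 N` colours for which the points
`x, T x, …, T^(N-1) x` have different colours. The colour is read off from the entrance time `τ`
into a set without returns before time `2 N`: it is `τ` itself if `τ < N`, and `N + τ mod N`
otherwise. -/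
theorem exists_colouring (hT : Ergodic T m) (hap : Aperiodic T m) {N : ℕ} (hN : 0 < N) :
    ∃ c : X → Fin (2 * N), Measurable c ∧
      ∀ᵐ x ∂m, Function.Injective fun k : Fin N => c (T^[k] x) := by
  classical
  obtain ⟨S, hS, hS0, hSr⟩ := exists_no_return hT.measurable hap (2 * N)
  let p : X → ℕ → Prop := fun x n => T^[n] x ∈ S ∨ ¬ ∃ n : ℕ, T^[n] x ∈ S
  have hp : ∀ x, ∃ n, p x n := by
    intro x
    by_cases h : ∃ n : ℕ, T^[n] x ∈ S
    · exact h.imp fun n hn => Or.inl hn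
    · exact ⟨0, Or.inr h⟩
  have hmem : ∀ n, MeasurableSet {x | T^[n] x ∈ S} := fun n => (hT.measurable.iterate n) hS
  have hpm : ∀ n, MeasurableSet {x | p x n} := fun n => by
    have h : {x | p x n} = {x | T^[n] x ∈ S} ∪ (⋃ n : ℕ, {x | T^[n] x ∈ S})ᶜ := by
      ext x; simp [p]
    rw [h]
    exact (hmem n).union (MeasurableSet.iUnion hmem).compl
  let τ : X → ℕ := fun x => Nat.find (hp x)
  have hτ : Measurable τ := measurable_find hp hpm
  have hτmem : ∀ x, (∃ n : ℕ, T^[n] x ∈ S) → T^[τ x] x ∈ S := fun x hx =>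
    (Nat.find_spec (hp x)).resolve_right (not_not.2 hx)
  have hτle : ∀ x n, T^[n] x ∈ S → τ x ≤ n := fun x n hn => Nat.find_min' (hp x) (Or.inl hn)
  let c : X → Fin (2 * N) := fun x =>
    if h : τ x < N then ⟨τ x, by omega⟩ else ⟨N + τ x % N, by have := Nat.mod_lt (τ x) hN; omega⟩
  have hcval : ∀ x, (c x : ℕ) = if τ x < N then τ x else N + τ x % N := by
    intro x; simp only [c]; split_ifs <;> rfl
  have hc : Measurable c := by
    have : c = (fun t : ℕ => if h : t < N then (⟨t, by omega⟩ : Fin (2 * N)) else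
      ⟨N + t % N, by have := Nat.mod_lt t hN; omega⟩) ∘ τ := rfl
    rw [this]
    exact measurable_from_nat.comp hτ
  have hkey : ∀ x, (∀ j : ℕ, ∃ n : ℕ, T^[n] (T^[j] x) ∈ S) → ∀ k, 1 ≤ k → k < N →
      c x ≠ c (T^[k] x) := by
    intro x hx k hk1 hkN h
    have h' : (c x : ℕ) = c (T^[k] x) := by rw [h]
    rw [hcval, hcval] at h'
    have hx0 : T^[τ x] x ∈ S := hτmem x (hx 0)
    have hxk : T^[τ (T^[k] x)] (T^[k] x) ∈ S := hτmem _ (hx k)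
    rw [← Function.iterate_add_apply] at hxk
    rcases Nat.lt_or_ge (τ x) k with hlt | hge
    · -- The orbit meets `S` before time `k`, so that the next visit is far away.
      have hfar : N ≤ τ (T^[k] x) := by
        by_contra hcon
        refine hSr (τ (T^[k] x) + k - τ x) (by omega) (by omega) _ hx0 ?_
        rwa [← Function.iterate_add_apply,
          show τ (T^[k] x) + k - τ x + τ x = τ (T^[k] x) + k by omega]
      rw [if_pos (by omega), if_neg (by omega)] at h'
      omega
    · have h1 : τ (T^[k] x) ≤ τ x - k := by
        apply hτle
        rwa [← Function.iterate_add_apply, Nat.sub_add_cancel hge]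
      have h2 : τ x ≤ τ (T^[k] x) + k := hτle _ _ hxk
      have h3 : τ x = τ (T^[k] x) + k := by omega
      have hmod : N + τ x % N ≠ N + τ (T^[k] x) % N := by
        intro hm
        have hm' : (τ (T^[k] x) + k) % N = τ (T^[k] x) % N := by rw [← h3]; omega
        have h4 : k ≡ 0 [MOD N] := Nat.ModEq.add_left_cancel' (τ (T^[k] x)) hm'
        rw [Nat.ModEq, Nat.mod_eq_of_lt hkN, Nat.zero_mod] at h4
        omega
      split_ifs at h' <;> omega
  refine ⟨c, hc, ?_⟩
  have hae := ae_exists_iterate_mem hT hS hS0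
  have hall : ∀ᵐ x ∂m, ∀ j : ℕ, ∃ n : ℕ, T^[n] (T^[j] x) ∈ S :=
    ae_all_iff.2 fun j => (hT.toMeasurePreserving.iterate j).quasiMeasurePreserving.ae hae
  filter_upwards [hall] with x hx
  have hlt : ∀ i j : Fin N, i < j → c (T^[i] x) ≠ c (T^[j] x) := by
    intro i j hij
    have h1 : (i : ℕ) < j := hij
    have := hkey (T^[i] x) (fun l => by
      rw [← Function.iterate_add_apply]; exact hx (l + i)) (j - i) (by omega) (by omega)
    rwa [← Function.iterate_add_apply, Nat.sub_add_cancel h1.le] at this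
  intro i j hij
  by_contra hne
  rcases lt_or_gt_of_ne hne with h | h
  · exact hlt i j h hij
  · exact hlt j i h hij.symm

end Colouring

/-! ### Functions with independent windows -/

/-- A countable conjunction of measurable conditions is measurable. -/
theorem measurableSet_ofPred_forall {X : Type*} [MeasurableSpace X] {ι : Sort*} [Countable ι]
    {p : ι → X → Prop} (h : ∀ i, MeasurableSet {x | p i x}) : MeasurableSet {x | ∀ i, p i x} := by
  have : {x | ∀ i, p i x} = ⋂ i, {x | p i x} := by ext x; simp
  rw [this]
  exact MeasurableSet.iInter h

section Window

variable {X : Type*} [MeasurableSpace X] [StandardBorelSpace X] {m : Measure X}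
  [IsProbabilityMeasure m] {T : X → X}

/-- Construction colour by colour. On the points of colour `i` the values are chosen by Lyapunov's
theorem independently of `Q`, of all the colours in the window and of the values already chosen on
smaller colours, at whatever place of the window the colour `i` occurs. -/
theorem exists_window_law_of_lt (hT : MeasurePreserving T m m) [NullSingletonClass m]
    {κ : Type*} [Finite κ] [MeasurableSpace κ] [MeasurableSingletonClass κ] {Q : X → κ}
    (hQ : Measurable Q) {N n : ℕ} {c : X → Fin n} (hc : Measurable c)
    {A : Type*} [Finite A] [MeasurableSpace A] [MeasurableSingletonClass A]
    (q : Measure A) [IsProbabilityMeasure q] (i : ℕ) :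
    ∃ f : X → A, Measurable f ∧ ∀ (r : κ) (d : Fin N → Fin n), Function.Injective d →
      ∀ w : Fin N → A,
      m {x | (Q x = r ∧ ∀ k : Fin N, c (T^[k] x) = d k) ∧
          ∀ k : Fin N, (d k : ℕ) < i → f (T^[k] x) = w k}
        = m {x | Q x = r ∧ ∀ k : Fin N, c (T^[k] x) = d k} *
          ∏ k with (d k : ℕ) < i, q {w k} := by
  classical
  induction i with
  | zero =>
    have : Nonempty A := q.nonempty_of_neZero
    exact ⟨fun _ => Classical.arbitrary A, measurable_const, fun r d hd w => by simp⟩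
  | succ i ih =>
    obtain ⟨f, hf, hfl⟩ := ih
    have hTk : ∀ k : ℕ, Measurable T^[k] := fun k => hT.measurable.iterate k
    let C : κ → (Fin N → Fin n) → (Fin N → A) → Set X := fun r d w =>
      {x | (Q x = r ∧ ∀ k : Fin N, c (T^[k] x) = d k) ∧
          ∀ k : Fin N, (d k : ℕ) < i → f (T^[k] x) = w k}
    have hC : ∀ r d w, MeasurableSet (C r d w) := by
      intro r d w
      refine MeasurableSet.inter (MeasurableSet.inter (hQ (measurableSet_singleton r)) ?_) ?_
      · exact measurableSet_ofPred_forall fun k => (hc.comp (hTk k)) (measurableSet_singleton _)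
      · exact measurableSet_ofPred_forall fun k => measurableSet_ofPred_forall fun _ =>
          (hf.comp (hTk k)) (measurableSet_singleton _)
    let μ : κ × (Fin N → Fin n) × (Fin N → A) × Fin N → Measure X := fun s =>
      (m.restrict (C s.1 s.2.1 s.2.2.1)).map T^[s.2.2.2]
    have hac : ∀ s, μ s ≪ m := by
      intro s
      have h1 := (Measure.absolutelyContinuous_of_le
        (Measure.restrict_le_self (μ := m) (s := C s.1 s.2.1 s.2.2.1))).map (hTk s.2.2.2)
      rwa [(hT.iterate _).map_eq] at h1
    obtain ⟨U, hU, hUq⟩ := exists_map_eq_smul m μ (fun s => inferInstance) hac q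
    have hsplit : ∀ r d w (k : Fin N) (a : A),
        m (C r d w ∩ {x | U (T^[k] x) = a}) = m (C r d w) * q {a} := by
      intro r d w k a
      have h1 := congrArg (fun ν : Measure A => ν {a}) (hUq (r, d, w, k))
      simp only [μ, Measure.smul_apply, smul_eq_mul] at h1
      rw [Measure.map_apply hU (measurableSet_singleton a),
        Measure.map_apply (hTk k) (hU (measurableSet_singleton a)),
        Measure.map_apply (hTk k) MeasurableSet.univ, Measure.restrict_apply
          ((hTk k) (hU (measurableSet_singleton a))), Set.preimage_univ,
        Measure.restrict_apply_univ, Set.inter_comm] at h1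
      exact h1
    refine ⟨fun x => if (c x : ℕ) = i then U x else f x,
      Measurable.ite (hc (Set.toFinite {z : Fin n | (z : ℕ) = i}).measurableSet) hU hf, ?_⟩
    intro r d hd w
    by_cases hk : ∃ k₀, (d k₀ : ℕ) = i
    · obtain ⟨k₀, hk₀⟩ := hk
      have hset : {x | (Q x = r ∧ ∀ k : Fin N, c (T^[k] x) = d k) ∧
          ∀ k : Fin N, (d k : ℕ) < i + 1 →
            (if (c (T^[k] x) : ℕ) = i then U (T^[k] x) else f (T^[k] x)) = w k}
          = C r d w ∩ {x | U (T^[k₀] x) = w k₀} := by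
        ext x
        simp only [C, Set.mem_inter_iff, Set.mem_ofPred_eq]
        constructor
        · rintro ⟨⟨h1, h2⟩, h3⟩
          refine ⟨⟨⟨h1, h2⟩, fun k hk => ?_⟩, ?_⟩
          · have := h3 k (by omega)
            rwa [h2 k, if_neg (by omega)] at this
          · have := h3 k₀ (by omega)
            rwa [h2 k₀, if_pos hk₀] at this
        · rintro ⟨⟨⟨h1, h2⟩, h3⟩, h4⟩
          refine ⟨⟨h1, h2⟩, fun k hk => ?_⟩
          rw [h2 k]
          by_cases hki : (d k : ℕ) = i
          · obtain rfl : k = k₀ := hd (Fin.ext (hki.trans hk₀.symm))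
            rw [if_pos hki]; exact h4
          · rw [if_neg hki]; exact h3 k (by omega)
      have hfilter : (Finset.univ.filter fun k => (d k : ℕ) < i + 1)
          = insert k₀ (Finset.univ.filter fun k => (d k : ℕ) < i) := by
        ext k
        simp only [Finset.mem_filter, Finset.mem_univ, true_and, Finset.mem_insert]
        constructor
        · intro h
          by_cases hki : (d k : ℕ) = i
          · exact Or.inl (hd (Fin.ext (hki.trans hk₀.symm)))
          · exact Or.inr (by omega)
        · rintro (rfl | h) <;> omega
      rw [hset, hsplit, hfl r d hd w, hfilter, Finset.prod_insert (by simp [hk₀])]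
      ring
    · push Not at hk
      have hset : {x | (Q x = r ∧ ∀ k : Fin N, c (T^[k] x) = d k) ∧
          ∀ k : Fin N, (d k : ℕ) < i + 1 →
            (if (c (T^[k] x) : ℕ) = i then U (T^[k] x) else f (T^[k] x)) = w k}
          = C r d w := by
        ext x
        simp only [C, Set.mem_ofPred_eq]
        refine and_congr_right fun h => forall_congr' fun k => ?_
        have h1 := hk k
        rw [h.2 k, if_neg h1]
        constructor
        · intro h2 h3; exact h2 (by omega)
        · intro h2 h3; exact h2 (by omega)
      have hfilter : (Finset.univ.filter fun k => (d k : ℕ) < i + 1)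
          = (Finset.univ.filter fun k => (d k : ℕ) < i) := by
        ext k
        have h1 := hk k
        simp only [Finset.mem_filter, Finset.mem_univ, true_and]
        omega
      rw [hset, hfl r d hd w, hfilter]

/-- In an ergodic aperiodic system, every law `q` on a finite set and every `N` admit a function
whose values along orbit segments of length `N` are independent with law `q`, and independent of a
given finite-valued function `Q`. -/
theorem exists_window_law (hT : Ergodic T m) (hap : Aperiodic T m)
    {κ : Type*} [Finite κ] [MeasurableSpace κ] [MeasurableSingletonClass κ] {Q : X → κ}
    (hQ : Measurable Q) (N : ℕ)
    {A : Type*} [Finite A] [MeasurableSpace A] [MeasurableSingletonClass A]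
    (q : Measure A) [IsProbabilityMeasure q] :
    ∃ f : X → A, Measurable f ∧ ∀ (r : κ) (w : Fin N → A),
      m {x | Q x = r ∧ ∀ k : Fin N, f (T^[k] x) = w k}
        = m {x | Q x = r} * ∏ k, q {w k} := by
  classical
  have : NullSingletonClass m := nullSingletonClass_of_aperiodic hT.toMeasurePreserving hap
  rcases Nat.eq_zero_or_pos N with rfl | hN
  · have : Nonempty A := q.nonempty_of_neZero
    exact ⟨fun _ => Classical.arbitrary A, measurable_const, fun r w => by simp⟩
  obtain ⟨c, hc, hcp⟩ := exists_colouring hT hap hN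
  obtain ⟨f, hf, hfl⟩ := exists_window_law_of_lt hT.toMeasurePreserving hQ (N := N) hc q (2 * N)
  refine ⟨f, hf, fun r w => ?_⟩
  have hTk : ∀ k : ℕ, Measurable T^[k] := fun k => hT.measurable.iterate k
  let col : X → Fin N → Fin (2 * N) := fun x k => c (T^[k] x)
  have hcol : Measurable col := measurable_pi_lambda _ fun k => hc.comp (hTk k)
  have hdecomp : ∀ S : Set X, m S = ∑ d : Fin N → Fin (2 * N), m (S ∩ {x | col x = d}) := by
    intro S
    have h1 := sum_measure_preimage_singleton (μ := m.restrict S)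
      (Finset.univ : Finset (Fin N → Fin (2 * N))) (f := col)
      (fun y _ => hcol (measurableSet_singleton y))
    simp only [Finset.coe_univ, Set.preimage_univ, Measure.restrict_apply_univ] at h1
    rw [← h1]
    refine Finset.sum_congr rfl fun d _ => ?_
    rw [Measure.restrict_apply (hcol (measurableSet_singleton d)), Set.inter_comm]
    rfl
  rw [hdecomp, hdecomp {x | Q x = r}, Finset.sum_mul]
  refine Finset.sum_congr rfl fun d _ => ?_
  by_cases hd : Function.Injective d
  · have h1 := hfl r d hd w
    have h2 : (Finset.univ.filter fun k => (d k : ℕ) < 2 * N) = Finset.univ := by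
      ext k; simp
    rw [h2] at h1
    convert h1 using 2
    · ext x
      simp only [col, Set.mem_inter_iff, Set.mem_ofPred_eq, funext_iff, Fin.is_lt, forall_const]
      tauto
    · congr 1
      ext x
      simp only [col, Set.mem_inter_iff, Set.mem_ofPred_eq, funext_iff]
  · have hnull : m {x | col x = d} = 0 := by
      refine measure_mono_null ?_ (ae_iff.1 hcp)
      rintro x rfl
      exact hd
    rw [measure_mono_null Set.inter_subset_right hnull,
      measure_mono_null Set.inter_subset_right hnull, zero_mul]

end Window

/-! ### Independence of arrays and the embedding -/

section Arrays

/-- A sequence of random variables, each independent of all the previous ones together, is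
independent. -/
theorem iIndepFun_of_indepFun_earlier {Ω : Type*} [MeasurableSpace Ω] {P : Measure Ω}
    [IsProbabilityMeasure P] {E : ℕ → Type*} [∀ k, MeasurableSpace (E k)]
    {Y : ∀ k, Ω → E k} (h : ∀ k, IndepFun (Y k) (fun ω (i : Fin k) => Y i ω) P) :
    iIndepFun Y P := by
  classical
  rw [iIndepFun_iff_measure_inter_preimage_eq_mul]
  intro S
  induction S using Finset.induction_on_max with
  | empty => intro _ _; simp
  | insert a s hs ih =>
    intro A hA
    have has : a ∉ s := fun h => lt_irrefl _ (hs a h)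
    have h1 := ih (sets := A) (fun i hi => hA i (Finset.mem_insert_of_mem hi))
    let B : Set (∀ i : Fin a, E i) := {z | ∀ i : Fin a, (i : ℕ) ∈ s → z i ∈ A i}
    have hB : MeasurableSet B := measurableSet_ofPred_forall fun i =>
      measurableSet_ofPred_forall fun hi =>
        (measurable_pi_apply i) (hA i (Finset.mem_insert_of_mem hi))
    have h2 : (⋂ i ∈ s, Y i ⁻¹' A i) = (fun ω (i : Fin a) => Y i ω) ⁻¹' B := by
      ext ω
      simp only [Set.mem_iInter, Set.mem_preimage, B, Set.mem_ofPred_eq]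
      exact ⟨fun h i hi => h i hi, fun h i hi => h ⟨i, hs i hi⟩ hi⟩
    rw [Finset.prod_insert has, ← h1, Finset.set_biInter_insert, h2]
    exact (h a).measure_inter_preimage_eq_mul _ _ (hA a (Finset.mem_insert_self _ _)) hB

/-- An array whose rows are independent families, each row being independent of the earlier ones,
is independent. Rows and columns are counted from `1` in the array, from `0` in the hypotheses. -/
theorem iIndepFun_array {Ω : Type*} [MeasurableSpace Ω] {P : Measure Ω} [IsProbabilityMeasure P]
    {α : ℝ} {Z : ℕ → ℕ → Ω → ℝ}
    (hmeas : ∀ k, ∀ j < 2 * blockLen α (k + 1), Measurable (Z (k + 1) (j + 1)))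
    (hrow : ∀ k, iIndepFun (fun j : Fin (2 * blockLen α (k + 1)) => Z (k + 1) (j + 1)) P)
    (hearlier : ∀ k, IndepFun
      (fun ω (j : Fin (2 * blockLen α (k + 1))) => Z (k + 1) (j + 1) ω)
      (fun ω (i : Fin k) (j : Fin (2 * blockLen α (i + 1))) => Z (i + 1) (j + 1) ω) P) :
    iIndepFun (fun p : ArrayIndex α => Z p.1.1 p.1.2) P := by
  have h1 : iIndepFun (fun (k : ℕ) ω (j : Fin (2 * blockLen α (k + 1))) => Z (k + 1) (j + 1) ω) P :=
    iIndepFun_of_indepFun_earlier hearlier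
  have h2 := iIndepFun_uncurry
    (X := fun (k : ℕ) (j : Fin (2 * blockLen α (k + 1))) ω => Z (k + 1) (j + 1) ω)
    (fun k j => hmeas k j j.2) h1 hrow
  let e : ArrayIndex α → (k : ℕ) × Fin (2 * blockLen α (k + 1)) := fun p =>
    ⟨p.1.1 - 1, ⟨p.1.2 - 1, by
      have := p.2
      rw [Nat.sub_add_cancel p.2.1]; omega⟩⟩
  have he : Function.Injective e := by
    rintro ⟨⟨k, j⟩, hk, hj, hj'⟩ ⟨⟨k', j'⟩, hk', hl, hl'⟩ h
    simp only [e] at h hk hk' hj hl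
    have hkk : k = k' := by have := congrArg Sigma.fst h; simp only at this; omega
    subst hkk
    have hjj : j - 1 = j' - 1 := by simpa using h
    have : j = j' := by omega
    subst this; rfl
  have h3 := h2.precomp he
  convert h3 using 2 with p
  obtain ⟨⟨k, j⟩, hk, hj, hj'⟩ := p
  simp only [e] at hk hj ⊢
  rw [Nat.sub_add_cancel hk, Nat.sub_add_cancel hj]

variable {X Ω : Type*} [MeasurableSpace X] [StandardBorelSpace X] [MeasurableSpace Ω]
  {m : Measure X} [IsProbabilityMeasure m] {T : X → X} {P : Measure Ω} [IsProbabilityMeasure P]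

/-- The random-variable form of `exists_window_law`: the values of `f` along orbit segments of
length `N` are independent copies of `ξ`, and are independent of `Q`. -/
theorem exists_iIndepFun_window (hT : Ergodic T m) (hap : Aperiodic T m)
    {Y : Type*} [MeasurableSpace Y] [MeasurableSingletonClass Y] {Q : X → Y} (hQ : Measurable Q)
    (hQfin : (Set.range Q).Finite) {N : ℕ} (hN : 0 < N) {ξ : Ω → ℝ} (hξ : Measurable ξ)
    (hξfin : (Set.range ξ).Finite) :
    ∃ f : X → ℝ, Measurable f ∧ (Set.range f).Finite ∧ m.map f = P.map ξ ∧
      iIndepFun (fun (j : Fin N) x => f (T^[j] x)) m ∧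
      IndepFun (fun x (j : Fin N) => f (T^[j] x)) Q m := by
  classical
  have := hQfin.to_subtype
  have := hξfin.to_subtype
  let ξ' : Ω → Set.range ξ := Set.rangeFactorization ξ
  have hξ' : Measurable ξ' := hξ.subtype_mk
  let Q' : X → Set.range Q := Set.rangeFactorization Q
  have hQ' : Measurable Q' := hQ.subtype_mk
  have : IsProbabilityMeasure (P.map ξ') := Measure.isProbabilityMeasure_map hξ'.aemeasurable
  have : IsProbabilityMeasure (m.map Q') := Measure.isProbabilityMeasure_map hQ'.aemeasurable
  obtain ⟨f, hf, hfl⟩ := exists_window_law hT hap hQ' N (P.map ξ')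
  have hTk : ∀ k : ℕ, Measurable T^[k] := fun k => hT.measurable.iterate k
  let W : X → Fin N → Set.range ξ := fun x j => f (T^[j] x)
  have hW : Measurable W := measurable_pi_lambda _ fun j => hf.comp (hTk j)
  have hjoint : m.map (fun x => (W x, Q' x))
      = (Measure.pi fun _ : Fin N => P.map ξ').prod (m.map Q') := by
    refine Measure.ext_iff_singleton.2 fun z => ?_
    obtain ⟨w, r⟩ := z
    rw [Measure.map_apply (hW.prodMk hQ') (measurableSet_singleton _),
      ← Set.singleton_prod_singleton,
      Measure.prod_prod, Measure.map_apply hQ' (measurableSet_singleton r), ← Set.univ_pi_singleton,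
      Measure.pi_pi, mul_comm]
    have h1 : (fun x => (W x, Q' x)) ⁻¹' (Set.univ.pi (fun i => {w i}) ×ˢ {r})
        = {x | Q' x = r ∧ ∀ k : Fin N, f (T^[k] x) = w k} := by
      ext x
      simp only [Set.mem_preimage, Set.mem_prod, Set.mem_pi, Set.mem_univ, forall_const,
        Set.mem_singleton_iff, Set.mem_ofPred_eq, W]
      exact and_comm
    rw [h1]
    exact hfl r w
  have hWlaw : m.map W = Measure.pi fun _ : Fin N => P.map ξ' := by
    have h := congrArg (fun ν => Measure.map Prod.fst ν) hjoint
    rw [Measure.map_map measurable_fst (hW.prodMk hQ'), Measure.map_fst_prod, measure_univ,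
      one_smul] at h
    exact h
  have hcoord : ∀ j : Fin N, m.map (fun x => f (T^[j] x)) = P.map ξ' := by
    intro j
    have h := congrArg (fun ν => Measure.map (Function.eval j) ν) hWlaw
    rw [Measure.map_map (measurable_pi_apply j) hW,
      (measurePreserving_eval (fun _ : Fin N => P.map ξ') j).map_eq] at h
    exact h
  have hindep : iIndepFun (fun (j : Fin N) x => f (T^[j] x)) m := by
    rw [iIndepFun_iff_map_fun_eq_pi_map (f := fun (j : Fin N) x => f (T^[j] x))
      fun j => (hf.comp (hTk j)).aemeasurable]
    simp_rw [hcoord]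
    exact hWlaw
  have hindepQ : IndepFun W Q' m := by
    rw [indepFun_iff_map_prod_eq_prod_map_map hW.aemeasurable hQ'.aemeasurable, hjoint, hWlaw]
  refine ⟨fun x => (f x : ℝ), measurable_subtype_coe.comp hf, ?_, ?_, ?_, ?_⟩
  · refine hξfin.subset ?_
    rintro _ ⟨x, rfl⟩
    exact (f x).2
  · have h := congrArg (fun ν => Measure.map (Subtype.val : Set.range ξ → ℝ) ν) (hcoord ⟨0, hN⟩)
    simp only [Function.iterate_zero, id] at h
    rw [Measure.map_map measurable_subtype_coe hf, Measure.map_map measurable_subtype_coe hξ'] at h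
    exact h
  · exact hindep.comp (fun _ => Subtype.val) fun _ => measurable_subtype_coe
  · exact hindepQ.comp (φ := fun w j => (w j : ℝ)) (ψ := Subtype.val)
      (measurable_pi_lambda _ fun j => measurable_subtype_coe.comp (measurable_pi_apply j))
      measurable_subtype_coe

/-- Iteration over the rows: an independent array with finite-valued entries, identically
distributed along each row, embeds in every ergodic aperiodic system. -/
theorem exists_iIndepFun_array (hT : Ergodic T m) (hap : Aperiodic T m) {N : ℕ → ℕ}
    (hN : ∀ k, 0 < N k) {ξ : ℕ → Ω → ℝ} (hξ : ∀ k, Measurable (ξ k))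
    (hξfin : ∀ k, (Set.range (ξ k)).Finite) :
    ∃ f : ℕ → X → ℝ, (∀ k, Measurable (f k)) ∧ (∀ k, m.map (f k) = P.map (ξ k)) ∧
      (∀ k, iIndepFun (fun (j : Fin (N k)) x => f k (T^[j] x)) m) ∧
      ∀ k, IndepFun (fun x (j : Fin (N k)) => f k (T^[j] x))
        (fun x (i : Fin k) (j : Fin (N i)) => f i (T^[j] x)) m := by
  classical
  let F : Type _ := {f : X → ℝ // Measurable f ∧ (Set.range f).Finite}
  let zero : F := ⟨fun _ => 0, measurable_const, (Set.finite_singleton (0 : ℝ)).subset (by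
    rintro _ ⟨x, rfl⟩; rfl)⟩
  have next : ∀ (k : ℕ) (g : ℕ → F), ∃ f : F, m.map f.1 = P.map (ξ k) ∧
      iIndepFun (fun (j : Fin (N k)) x => f.1 (T^[j] x)) m ∧
      IndepFun (fun x (j : Fin (N k)) => f.1 (T^[j] x))
        (fun x (i : Fin k) (j : Fin (N i)) => (g i).1 (T^[j] x)) m := by
    intro k g
    have hmeas : Measurable fun x (i : Fin k) (j : Fin (N i)) => (g i).1 (T^[j] x) :=
      measurable_pi_lambda _ fun i => measurable_pi_lambda _ fun j =>
        (g i).2.1.comp (hT.measurable.iterate j)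
    have hfin : (Set.range fun x (i : Fin k) (j : Fin (N i)) => (g i).1 (T^[j] x)).Finite := by
      refine (Set.Finite.pi' (t := fun i : Fin k => {z : Fin (N i) → ℝ |
        ∀ j, z j ∈ Set.range (g i).1}) fun i => Set.Finite.pi' fun j => (g i).2.2).subset ?_
      rintro _ ⟨x, rfl⟩ i j
      exact ⟨_, rfl⟩
    obtain ⟨f, h1, h2, h3, h4, h5⟩ :=
      exists_iIndepFun_window (P := P) hT hap hmeas hfin (hN k) (hξ k) (hξfin k)
    exact ⟨⟨f, h1, h2⟩, h3, h4, h5⟩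
  choose nx hnx1 hnx2 hnx3 using next
  let f : ℕ → F := Nat.lt_wfRel.wf.fix fun k ih =>
    nx k fun j => if h : j < k then ih j h else zero
  have hf : ∀ k, f k = nx k fun j => if j < k then f j else zero := by
    intro k
    simp only [f]
    rw [WellFounded.fix_eq]
    rfl
  refine ⟨fun k => (f k).1, fun k => (f k).2.1, fun k => ?_, fun k => ?_, fun k => ?_⟩
  · have h := hnx1 k fun j => if j < k then f j else zero
    rwa [← hf k] at h
  · have h := hnx2 k fun j => if j < k then f j else zero
    rwa [← hf k] at h
  · have h := hnx3 k fun j => if j < k then f j else zero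
    rw [← hf k] at h
    simpa using h

end Arrays

/-! ### The truncated and discretised array -/

/-- The map `X_k(j) ↦ Z_k(j)`: truncation to `[2^k, 2^(k²)]` followed by discretisation. -/
noncomputable def quantise (L : ℕ → ℕ) (t : ℕ → ℕ → ℝ) (k : ℕ) (x : ℝ) : ℝ :=
  discretise (L k) (t k) (truncate k x)

theorem measurable_discretise (N : ℕ) (t : ℕ → ℝ) : Measurable (discretise N t) := by
  classical
  have hsign : Measurable Real.sign := by
    unfold Real.sign
    exact Measurable.ite measurableSet_Iio measurable_const
      (Measurable.ite measurableSet_Ioi measurable_const measurable_const)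
  unfold discretise
  refine Finset.measurable_sum _ fun l _ => Measurable.ite ?_ (hsign.mul_const _) measurable_const
  exact (measurableSet_le measurable_const measurable_norm).inter
    (measurableSet_lt measurable_norm measurable_const)

theorem measurable_truncate (k : ℕ) : Measurable (truncate k) := by
  classical
  unfold truncate
  refine Measurable.ite ?_ measurable_id measurable_const
  exact (measurableSet_le measurable_const measurable_norm).inter
    (measurableSet_le measurable_norm measurable_const)

theorem measurable_quantise (L : ℕ → ℕ) (t : ℕ → ℕ → ℝ) (k : ℕ) : Measurable (quantise L t k) :=
  (measurable_discretise _ _).comp (measurable_truncate k)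

theorem finite_range_discretise (N : ℕ) (t : ℕ → ℝ) : (Set.range (discretise N t)).Finite := by
  classical
  induction N with
  | zero =>
    refine (Set.finite_singleton (0 : ℝ)).subset ?_
    rintro _ ⟨y, rfl⟩
    simp [discretise]
  | succ N ih =>
    refine (Set.Finite.image2 (fun a b : ℝ => a + b) ih
      (Set.toFinite ({0, -t N, t N} : Set ℝ))).subset ?_
    rintro _ ⟨y, rfl⟩
    have h : discretise (N + 1) t y = discretise N t y +
        if t N ≤ |y| ∧ |y| < t (N + 1) then Real.sign y * t N else 0 := by
      simp only [discretise, Finset.sum_range_succ]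
    rw [h]
    refine ⟨_, ⟨y, rfl⟩, _, ?_, rfl⟩
    split_ifs
    · rcases Real.sign_apply_eq y with h | h | h <;> simp [h]
    · simp

theorem discretise_eq {N : ℕ} {t : ℕ → ℝ} (ht : ∀ l < N, 0 < t (l + 1) - t l) {y : ℝ} {l : ℕ}
    (hl : l < N) (h1 : t l ≤ |y|) (h2 : |y| < t (l + 1)) :
    discretise N t y = Real.sign y * t l := by
  classical
  have hmono : ∀ a b, a ≤ b → b ≤ N → t a ≤ t b := by
    intro a b hab
    induction b, hab using Nat.le_induction with
    | base => intro _; exact le_rfl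
    | succ b hb ih =>
      intro hbN
      have := ih (by omega)
      have := ht b (by omega)
      linarith
  unfold discretise
  rw [Finset.sum_eq_single l]
  · rw [if_pos ⟨h1, h2⟩]
  · intro l' hl' hne
    rw [if_neg]
    rintro ⟨h3, h4⟩
    rw [Finset.mem_range] at hl'
    rcases lt_or_gt_of_ne hne with h | h
    · have := hmono (l' + 1) l h hl.le
      linarith
    · have := hmono (l + 1) l' h hl'.le
      linarith
  · intro h; exact absurd (Finset.mem_range.2 hl) h

theorem discretise_eq_zero {N : ℕ} {t : ℕ → ℝ} {y : ℝ}
    (h : ∀ l < N, ¬ (t l ≤ |y| ∧ |y| < t (l + 1))) : discretise N t y = 0 := by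
  classical
  unfold discretise
  exact Finset.sum_eq_zero fun l hl => if_neg (h l (Finset.mem_range.1 hl))

theorem quantise_neg (L : ℕ → ℕ) (t : ℕ → ℕ → ℝ) (k : ℕ) (x : ℝ) :
    quantise L t k (-x) = -quantise L t k x := by
  classical
  have h1 : truncate k (-x) = -truncate k x := by
    unfold truncate; rw [abs_neg]; split_ifs <;> simp
  unfold quantise
  rw [h1]
  unfold discretise
  rw [← Finset.sum_neg_distrib]
  refine Finset.sum_congr rfl fun l _ => ?_
  rw [abs_neg, Real.sign_neg]
  split_ifs <;> simp

section Partition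

variable {α : ℝ} {L : ℕ → ℕ} {t : ℕ → ℕ → ℝ} (ht : IsPartition α L t) {k : ℕ} (hk : 1 ≤ k)
include ht hk

theorem IsPartition.le_apply {l : ℕ} (hl : l ≤ L k) : (2 : ℝ) ^ k ≤ t k l := by
  induction l with
  | zero => rw [ht.first k hk]
  | succ l ih =>
    have h1 := ih (by omega)
    have h2 := ht.step_pos k l hk (by omega)
    linarith

theorem quantise_eq_zero {x : ℝ} (hx : |x| < 2 ^ k) : quantise L t k x = 0 := by
  have h1 : truncate k x = 0 := by
    unfold truncate; rw [if_neg]; intro h; linarith [h.1]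
  unfold quantise
  rw [h1]
  refine discretise_eq_zero fun l hl h => ?_
  have h2 := ht.le_apply hk hl.le
  have h3 : (0 : ℝ) < 2 ^ k := by positivity
  rw [abs_zero] at h
  linarith [h.1]

/-- The inequality `|x| < 2^(k²)` is strict because the last point of the partition is itself sent
to `0`. -/
theorem abs_quantise_sub_le {x : ℝ} (hx : (2 : ℝ) ^ k ≤ |x|) (hx' : |x| < 2 ^ (k ^ 2)) :
    |quantise L t k x - x| ≤ 1 / blockLen α k := by
  have h1 : truncate k x = x := by
    unfold truncate; rw [if_pos ⟨hx, hx'.le⟩]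
  have hex : ∃ l < L k, t k l ≤ |x| ∧ |x| < t k (l + 1) := by
    by_contra hcon
    push Not at hcon
    have : ∀ l ≤ L k, t k l ≤ |x| := by
      intro l
      induction l with
      | zero => intro _; rw [ht.first k hk]; exact hx
      | succ l ih => intro hl; exact hcon l (by omega) (ih (by omega))
    have h2 := this (L k) le_rfl
    rw [ht.last k hk] at h2
    linarith
  obtain ⟨l, hl, h2, h3⟩ := hex
  unfold quantise
  rw [h1, discretise_eq (fun l hl => ht.step_pos k l hk hl) hl h2 h3]
  have h4 := ht.step_le k l hk hl
  have h5 : (0 : ℝ) < 2 ^ k := by positivity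
  rcases lt_or_ge x 0 with h | h
  · rw [abs_of_neg h] at h2 h3
    rw [Real.sign_of_neg h, abs_le]
    constructor <;> linarith
  · rw [abs_of_nonneg h] at h2 h3 hx
    rw [Real.sign_of_pos (by linarith), abs_le]
    constructor <;> linarith

theorem abs_quantise_le (x : ℝ) : |quantise L t k x| ≤ |x| := by
  by_cases hex : ∃ l < L k, t k l ≤ |truncate k x| ∧ |truncate k x| < t k (l + 1)
  · obtain ⟨l, hl, h2, h3⟩ := hex
    have h4 : |truncate k x| ≤ |x| := by
      unfold truncate; split_ifs
      · exact le_rfl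
      · simp
    have h5 : 0 ≤ t k l := le_trans (by positivity) (ht.le_apply hk hl.le)
    have h6 : |Real.sign (truncate k x)| ≤ 1 := by
      rcases Real.sign_apply_eq (truncate k x) with h | h | h <;> simp [h]
    unfold quantise
    rw [discretise_eq (fun l hl => ht.step_pos k l hk hl) hl h2 h3, abs_mul, abs_of_nonneg h5]
    nlinarith
  · push Not at hex
    unfold quantise
    rw [discretise_eq_zero fun l hl h => absurd h.2 (not_lt.2 (hex l hl h.1))]
    simp

end Partition

theorem blockLen_pos {α : ℝ} (hα0 : 0 < α) (hα2 : α < 2) (k : ℕ) : 0 < blockLen α k := by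
  unfold blockLen
  rw [Nat.floor_pos]
  exact Real.one_le_rpow one_le_two (div_nonneg (by positivity) (by linarith))

section Array

variable {Ω : Type*} [MeasurableSpace Ω] {P : Measure Ω} {α : ℝ} {X : ℕ → ℕ → Ω → ℝ}

theorem IsSAS.measure_eq {α σ : ℝ} {μ ν : Measure ℝ} (hμ : IsSAS α σ μ) (hν : IsSAS α σ ν) :
    μ = ν := by
  have := hμ.isProbabilityMeasure
  have := hν.isProbabilityMeasure
  refine Measure.ext_of_charFun ?_
  ext θ
  rw [hμ.charFun_eq, hν.charFun_eq]

theorem measurable_arrayZ (hX : IsStableArray α P X) (L : ℕ → ℕ) (t : ℕ → ℕ → ℝ) {k j : ℕ}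
    (hk : 1 ≤ k) (hj : j ≤ 2 * blockLen α k) : Measurable (arrayZ L t X k j) :=
  (measurable_quantise L t k).comp (hX.measurable k j hk hj)

theorem map_arrayZ (hX : IsStableArray α P X) (L : ℕ → ℕ) (t : ℕ → ℕ → ℝ) {k j : ℕ}
    (hk : 1 ≤ k) (hj : j ≤ 2 * blockLen α k) :
    P.map (arrayZ L t X k j) = (P.map (X k 0)).map (quantise L t k) := by
  rw [(hX.law k 0 hk (Nat.zero_le _)).measure_eq (hX.law k j hk hj),
    Measure.map_map (measurable_quantise L t k) (hX.measurable k j hk hj)]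
  rfl

theorem iIndepFun_arrayZ [IsProbabilityMeasure P] (hX : IsStableArray α P X)
    (L : ℕ → ℕ) (t : ℕ → ℕ → ℝ) :
    iIndepFun (fun p : ArrayIndex α => arrayZ L t X p.1.1 p.1.2) P := by
  refine iIndepFun_array ?_ ?_ ?_
  · intro k j hj
    exact measurable_arrayZ hX L t (by omega) (by omega)
  · intro k
    have h := (hX.indep_row (k + 1) (by omega)).precomp
      (g := fun j : Fin (2 * blockLen α (k + 1)) => j.succ) (Fin.succ_injective _)
    exact h.comp (fun _ => quantise L t (k + 1)) fun _ => measurable_quantise L t (k + 1)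
  · intro k
    let φ : (Fin (2 * blockLen α (k + 1) + 1) → ℝ) → Fin (2 * blockLen α (k + 1)) → ℝ :=
      fun z j => quantise L t (k + 1) (z j.succ)
    have hmem : ∀ (i : Fin k) (j : Fin (2 * blockLen α (i + 1))),
        1 ≤ (i : ℕ) + 1 ∧ (i : ℕ) + 1 < k + 1 ∧ (j : ℕ) + 1 ≤ 2 * blockLen α (i + 1) :=
      fun i j => ⟨by omega, by omega, j.2⟩
    let ψ : ({p : ℕ × ℕ // 1 ≤ p.1 ∧ p.1 < k + 1 ∧ p.2 ≤ 2 * blockLen α p.1} → ℝ) →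
        (i : Fin k) → Fin (2 * blockLen α (i + 1)) → ℝ :=
      fun z i j => quantise L t (i + 1) (z ⟨(i + 1, j + 1), hmem i j⟩)
    have hφ : Measurable φ := measurable_pi_lambda _ fun j =>
      (measurable_quantise L t (k + 1)).comp (measurable_pi_apply _)
    have hψ : Measurable ψ := measurable_pi_lambda _ fun i => measurable_pi_lambda _ fun j =>
      (measurable_quantise L t (i + 1)).comp (measurable_pi_apply _)
    exact (hX.indep_earlier (k + 1) (by omega)).comp hφ hψ

/-- Every ergodic aperiodic system carries a copy of the discretised array. -/
theorem exists_isEmbedding {𝒳 : Type*} [MeasurableSpace 𝒳] [StandardBorelSpace 𝒳]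
    {m : Measure 𝒳} [IsProbabilityMeasure m] {T : 𝒳 → 𝒳} (hT : Ergodic T m)
    (hap : Aperiodic T m) [IsProbabilityMeasure P] (hα0 : 0 < α) (hα2 : α < 2)
    (hX : IsStableArray α P X) (L : ℕ → ℕ) (t : ℕ → ℕ → ℝ) :
    ∃ f : ℕ → 𝒳 → ℝ, IsEmbedding α m T P (arrayZ L t X) f := by
  obtain ⟨f, hf, hlaw, hrow, hearlier⟩ := exists_iIndepFun_array (P := P) hT hap
    (N := fun k => 2 * blockLen α (k + 1)) (ξ := fun k => arrayZ L t X (k + 1) 0)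
    (fun k => Nat.mul_pos two_pos (blockLen_pos hα0 hα2 (k + 1)))
    (fun k => measurable_arrayZ hX L t (by omega) (by omega))
    (fun k => (finite_range_discretise (L (k + 1)) (t (k + 1))).subset
      (by rintro _ ⟨ω, rfl⟩; exact ⟨_, rfl⟩))
  have hTk : ∀ k : ℕ, Measurable T^[k] := fun k => hT.measurable.iterate k
  refine ⟨fun k => f (k - 1), fun k _ => hf _, ?_⟩
  refine IdentDistrib.pi (fun p => ?_) ?_ (iIndepFun_arrayZ hX L t)
  · obtain ⟨⟨k, j⟩, hk, hj, hj'⟩ := p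
    simp only at hk hj hj' ⊢
    refine ⟨((hf _).comp (hTk _)).aemeasurable,
      (measurable_arrayZ hX L t hk hj').aemeasurable, ?_⟩
    have h1 : m.map (fun x => f (k - 1) (T^[j - 1] x)) = m.map (f (k - 1)) := by
      have h := (hT.toMeasurePreserving.iterate (j - 1)).map_eq
      conv_rhs => rw [← h]
      rw [Measure.map_map (hf _) (hTk _)]
      rfl
    have h2 := hlaw (k - 1)
    rw [Nat.sub_add_cancel hk] at h2
    rw [h1, h2, map_arrayZ hX L t hk (Nat.zero_le _), map_arrayZ hX L t hk hj']
  · refine iIndepFun_array (Z := fun k j x => f (k - 1) (T^[j - 1] x)) ?_ ?_ ?_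
    · intro k j _
      exact (hf _).comp (hTk _)
    · intro k
      simpa using hrow k
    · intro k
      simpa using hearlier k

end Array

/-! ### Truncated moments and characteristic functions -/

section TruncatedMoment

/-- A pointwise bound behind the passage from tails to characteristic functions, since
`1 - sinc y` is the average of `1 - cos (s y)` over `|s| ≤ 1`. The constant is not optimal. -/
theorem min_one_sq_le (y : ℝ) : min 1 (y ^ 2) ≤ 40 * (1 - Real.sinc y) := by
  wlog hy : 0 ≤ y generalizing y with H
  · have := H (-y) (by linarith)
    rwa [neg_sq, Real.sinc_neg] at this
  have small : ∀ z : ℝ, 0 < z → z ≤ 1 → Real.sinc z ≤ 1 - 3 / 20 * z ^ 2 := by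
    intro z hz hz1
    have h := Real.sin_bound (x := z) (by rwa [abs_of_pos hz])
    rw [abs_of_pos hz, abs_le] at h
    rw [Real.sinc_of_ne_zero hz.ne', div_le_iff₀ hz]
    have h5 : z ^ 5 ≤ z ^ 3 := pow_le_pow_of_le_one hz.le hz1 (by norm_num)
    have h3 : 0 ≤ z ^ 3 := by positivity
    nlinarith [h.2]
  rcases hy.eq_or_lt with rfl | hy
  · simp
  rcases le_or_gt y 1 with h1 | h1
  · have := small y hy h1
    have h2 := min_le_right 1 (y ^ 2)
    nlinarith [sq_nonneg y]
  refine (min_le_left _ _).trans ?_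
  rcases le_or_gt y 2 with h2 | h2
  · have h3 := small (y / 2) (by linarith) (by linarith)
    have h4 : Real.sinc y ≤ |Real.sinc (y / 2)| := by
      rw [Real.sinc_of_ne_zero hy.ne', Real.sinc_of_ne_zero (by linarith : y / 2 ≠ 0),
        show Real.sin y = 2 * Real.sin (y / 2) * Real.cos (y / 2) by
          rw [← Real.sin_two_mul]; ring_nf]
      have h5 : 2 * Real.sin (y / 2) * Real.cos (y / 2) / y
          = Real.sin (y / 2) / (y / 2) * Real.cos (y / 2) := by field_simp
      rw [h5]
      refine (le_abs_self _).trans ?_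
      rw [abs_mul]
      exact mul_le_of_le_one_right (abs_nonneg _) (Real.abs_cos_le_one _)
    have h6 : 0 ≤ Real.sinc (y / 2) := by
      rw [Real.sinc_of_ne_zero (by linarith : y / 2 ≠ 0)]
      exact div_nonneg (Real.sin_nonneg_of_nonneg_of_le_pi (by linarith)
        (by linarith [Real.pi_gt_three])) (by linarith)
    rw [abs_of_nonneg h6] at h4
    nlinarith
  · have h3 := Real.sinc_le_inv_abs hy.ne'
    rw [abs_of_pos hy] at h3
    have h4 : y⁻¹ ≤ 2⁻¹ := inv_anti₀ two_pos h2.le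
    linarith

/-- The truncated second moment `E[min(1, (v X)²)]` for `X` of law `μ`. -/
noncomputable def truncMoment (μ : Measure ℝ) (v : ℝ) : ℝ := ∫ x, min 1 ((v * x) ^ 2) ∂μ

variable {μ : Measure ℝ} [IsProbabilityMeasure μ]

theorem integrable_min_one_sq (v : ℝ) : Integrable (fun x : ℝ => min 1 ((v * x) ^ 2)) μ := by
  refine Integrable.of_bound (by fun_prop) 1 (Eventually.of_forall fun x => ?_)
  rw [Real.norm_eq_abs, abs_of_nonneg (le_min zero_le_one (sq_nonneg _))]
  exact min_le_left _ _

theorem integrable_cos_mul {q : ℝ → ℝ} (hq : Measurable q) (u : ℝ) :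
    Integrable (fun x => Real.cos (u * q x)) μ :=
  Integrable.of_bound (by fun_prop) 1 (Eventually.of_forall fun x => Real.abs_cos_le_one _)

/-- Markov's inequality for a function vanishing on `|x| < a`. -/
theorem measureReal_ne_zero_le {q : ℝ → ℝ} (hq : Measurable q) {a : ℝ} (ha : 0 < a)
    (hq0 : ∀ x, |x| < a → q x = 0) : μ.real {x | q x ≠ 0} ≤ truncMoment μ (1 / a) := by
  have hm : MeasurableSet {x | q x ≠ 0} := (hq (measurableSet_singleton 0)).compl
  rw [← integral_indicator_one hm]
  refine integral_mono ((integrable_const _).indicator hm) (integrable_min_one_sq _) fun x => ?_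
  simp only
  by_cases hx : q x ≠ 0
  · rw [Set.indicator_of_mem (by exact hx)]
    have h4 : 1 ≤ (1 / a * x) ^ 2 := by
      rw [one_le_sq_iff_one_le_abs, abs_mul, abs_of_pos (by positivity : 0 < 1 / a),
        one_div_mul_eq_div, one_le_div ha]
      by_contra hlt
      exact hx (hq0 x (not_le.1 hlt))
    rw [min_eq_left h4]; rfl
  · rw [Set.indicator_of_notMem (by exact hx)]
    positivity

variable {α c : ℝ} (hμ : ∀ θ : ℝ, charFun μ θ = ((Real.exp (-(c * |θ| ^ α)) : ℝ) : ℂ))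
include hμ

/-- The truncated moment is controlled by the average of `1 - charFun` over `[-v, v]`. -/
theorem truncMoment_le (hα : 0 < α) (hc : 0 ≤ c) {v : ℝ} (hv : 0 ≤ v) :
    truncMoment μ v ≤ 40 * (c * v ^ α) := by
  rcases hv.eq_or_lt with rfl | hv
  · simp [truncMoment, Real.zero_rpow hα.ne']
  have hsinc : Integrable (fun x => Real.sinc (v * x)) μ :=
    Integrable.of_bound (Real.measurable_sinc.comp (measurable_const_mul v)).aestronglyMeasurable 1
      (Eventually.of_forall fun x => Real.abs_sinc_le_one _)
  have h1 : truncMoment μ v ≤ 40 * (1 - ∫ x, Real.sinc (v * x) ∂μ) := by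
    calc truncMoment μ v ≤ ∫ x, 40 * (1 - Real.sinc (v * x)) ∂μ :=
          integral_mono (integrable_min_one_sq v) (((integrable_const _).sub hsinc).const_mul _)
            fun x => min_one_sq_le (v * x)
      _ = _ := by
          rw [integral_const_mul, integral_sub (integrable_const _) hsinc]
          simp
  have h2 := integral_charFun_Icc (μ := μ) hv
  have h3 : (2 * v * (1 - ∫ x, Real.sinc (v * x) ∂μ) : ℝ) ≤ c * v ^ α * (2 * v) := by
    have h4 : ((2 * v * (1 - ∫ x, Real.sinc (v * x) ∂μ) : ℝ) : ℂ)
        = ∫ t in -v..v, (1 - charFun μ t) := by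
      rw [intervalIntegral.integral_sub intervalIntegrable_const intervalIntegrable_charFun, h2,
        intervalIntegral.integral_const]
      push_cast
      rw [Complex.real_smul]
      push_cast
      ring
    have h5 : ‖∫ t in -v..v, (1 - charFun μ t)‖ ≤ c * v ^ α * |v - -v| := by
      refine intervalIntegral.norm_integral_le_of_norm_le_const fun t ht => ?_
      rw [Set.uIoc_of_le (by linarith)] at ht
      have ht' : |t| ≤ v := abs_le.2 ⟨ht.1.le, ht.2⟩
      have h6 : |t| ^ α ≤ v ^ α := Real.rpow_le_rpow (abs_nonneg t) ht' hα.le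
      have h7 : 0 ≤ c * |t| ^ α := mul_nonneg hc (Real.rpow_nonneg (abs_nonneg t) α)
      rw [hμ, ← Complex.ofReal_one, ← Complex.ofReal_sub, Complex.norm_real, Real.norm_eq_abs,
        abs_of_nonneg (by linarith [Real.exp_le_one_iff.2 (neg_nonpos.2 h7)])]
      have h8 := Real.add_one_le_exp (-(c * |t| ^ α))
      have h9 := mul_le_mul_of_nonneg_left h6 hc
      linarith
    rw [← h4, Complex.norm_real, Real.norm_eq_abs, show v - -v = 2 * v by ring,
      abs_of_pos (by linarith : 0 < 2 * v)] at h5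
    exact (le_abs_self _).trans h5
  have h10 : 1 - ∫ x, Real.sinc (v * x) ∂μ ≤ c * v ^ α := by
    have : 0 < 2 * v := by linarith
    nlinarith
  linarith

theorem map_neg_eq : μ.map (fun x => -x) = μ := by
  have : IsProbabilityMeasure (μ.map fun x : ℝ => -x) :=
    Measure.isProbabilityMeasure_map measurable_neg.aemeasurable
  refine Measure.ext_of_charFun ?_
  ext θ
  have h : (fun x : ℝ => -x) = fun x => (-1) * x := by ext x; ring
  rw [h, charFun_map_mul, hμ, hμ]
  simp

/-- The law of an odd function of a symmetric variable is symmetric, so that its characteristic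
function is real. -/
theorem charFun_map_eq_integral_cos {q : ℝ → ℝ} (hq : Measurable q) (hodd : ∀ x, q (-x) = -q x)
    (u : ℝ) : charFun (μ.map q) u = ((∫ x, Real.cos (u * q x) ∂μ : ℝ) : ℂ) := by
  have hint : Integrable (fun x => Complex.exp (u * q x * Complex.I)) μ := by
    refine Integrable.of_bound (by fun_prop) 1 (Eventually.of_forall fun x => ?_)
    rw [← Complex.ofReal_mul, Complex.norm_exp_ofReal_mul_I]
  have h1 : charFun (μ.map q) u = ∫ x, Complex.exp (u * q x * Complex.I) ∂μ := by
    rw [charFun_apply_real, integral_map hq.aemeasurable (by fun_prop)]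
  have h2 : ∫ x, Complex.exp (u * q x * Complex.I) ∂μ
      = ∫ x, Complex.exp (-(u * q x) * Complex.I) ∂μ := by
    conv_lhs => rw [← map_neg_eq hμ]
    rw [integral_map measurable_neg.aemeasurable (by fun_prop)]
    refine integral_congr_ae (Eventually.of_forall fun x => ?_)
    simp only [hodd]
    push_cast
    ring_nf
  have hint' : Integrable (fun x => Complex.exp (-(u * q x) * Complex.I)) μ := by
    refine Integrable.of_bound (by fun_prop) 1 (Eventually.of_forall fun x => ?_)
    rw [← Complex.ofReal_mul, ← Complex.ofReal_neg, Complex.norm_exp_ofReal_mul_I]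
  rw [h1, ← integral_complex_ofReal]
  have h3 : ∫ x, ((Real.cos (u * q x) : ℝ) : ℂ) ∂μ = ((∫ x, Complex.exp (u * q x * Complex.I) ∂μ)
      + ∫ x, Complex.exp (-(u * q x) * Complex.I) ∂μ) / 2 := by
    rw [← integral_add hint hint', ← integral_div]
    refine integral_congr_ae (Eventually.of_forall fun x => ?_)
    simp only [Complex.ofReal_cos, Complex.cos, Complex.ofReal_mul]
  rw [h3, ← h2]
  ring

/-- Shrinking the values of a symmetric variable keeps `1 - charFun` of the order of the truncated
moment, as `1 - cos y ≤ 2 min (1, y²)`. -/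
theorem norm_one_sub_charFun_map_le {q : ℝ → ℝ} (hq : Measurable q)
    (hodd : ∀ x, q (-x) = -q x) (hle : ∀ x, |q x| ≤ |x|) (u : ℝ) :
    ‖1 - charFun (μ.map q) u‖ ≤ 2 * truncMoment μ |u| := by
  rw [charFun_map_eq_integral_cos hμ hq hodd, ← Complex.ofReal_one, ← Complex.ofReal_sub,
    Complex.norm_real, Real.norm_eq_abs]
  have hi := integrable_cos_mul (μ := μ) hq u
  have h1 : 1 - ∫ x, Real.cos (u * q x) ∂μ = ∫ x, (1 - Real.cos (u * q x)) ∂μ := by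
    rw [integral_sub (integrable_const _) hi]; simp
  rw [h1, abs_of_nonneg (integral_nonneg fun x => by
    simp only [Pi.zero_apply]; linarith [Real.cos_le_one (u * q x)]), truncMoment,
    ← integral_const_mul]
  refine integral_mono ((integrable_const _).sub hi) ((integrable_min_one_sq _).const_mul _)
    fun x => ?_
  simp only
  have h2 := Real.one_sub_sq_div_two_le_cos (x := u * q x)
  have h3 := Real.neg_one_le_cos (u * q x)
  have h4 : (u * q x) ^ 2 ≤ (|u| * x) ^ 2 := by
    rw [mul_pow, mul_pow, sq_abs]
    exact mul_le_mul_of_nonneg_left (sq_le_sq.2 (hle x)) (sq_nonneg u)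
  rcases min_choice 1 ((|u| * x) ^ 2) with h | h <;> rw [h] <;> nlinarith [sq_nonneg (|u| * x)]

/-- Effect on the characteristic function of an odd map `q` that kills `|x| < a`, moves points with
`a ≤ |x| < b` by at most `δ`, and is arbitrary beyond. Oddness makes the first error quadratic
in `u`. -/
theorem norm_charFun_map_sub_le {q : ℝ → ℝ} (hq : Measurable q) (hodd : ∀ x, q (-x) = -q x)
    {a b δ : ℝ} (ha : 0 < a) (hb : 0 < b) (hδ : 0 ≤ δ) (hq0 : ∀ x, |x| < a → q x = 0)
    (hqx : ∀ x, a ≤ |x| → |x| < b → |q x - x| ≤ δ) (u : ℝ) :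
    ‖charFun (μ.map q) u - charFun μ u‖
      ≤ u ^ 2 * a ^ 2 * truncMoment μ (1 / a) + |u| * δ + 2 * truncMoment μ (1 / b) := by
  have hid := charFun_map_eq_integral_cos hμ measurable_id (fun x => rfl) u
  rw [Measure.map_id] at hid
  rw [charFun_map_eq_integral_cos hμ hq hodd, hid, ← Complex.ofReal_sub, Complex.norm_real,
    Real.norm_eq_abs]
  have hi := integrable_cos_mul (μ := μ) hq u
  have hi' := integrable_cos_mul (μ := μ) measurable_id u
  rw [← integral_sub hi hi']
  refine (abs_integral_le_integral_abs).trans ?_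
  have hia := (integrable_min_one_sq (μ := μ) (1 / a)).const_mul (u ^ 2 * a ^ 2)
  have hib := (integrable_min_one_sq (μ := μ) (1 / b)).const_mul 2
  have hsum : u ^ 2 * a ^ 2 * truncMoment μ (1 / a) + |u| * δ + 2 * truncMoment μ (1 / b)
      = ∫ x, (u ^ 2 * a ^ 2 * min 1 ((1 / a * x) ^ 2) + |u| * δ
        + 2 * min 1 ((1 / b * x) ^ 2)) ∂μ := by
    rw [integral_add (f := fun x => u ^ 2 * a ^ 2 * min 1 ((1 / a * x) ^ 2) + |u| * δ)
        (hia.add (integrable_const _)) hib, integral_add hia (integrable_const _),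
      integral_const_mul, integral_const_mul]
    simp [truncMoment, integral_const_mul]
  rw [hsum]
  refine integral_mono (hi.sub hi').abs ((hia.add (integrable_const _)).add hib) fun x => ?_
  simp only [id]
  have h1 : 0 ≤ u ^ 2 * a ^ 2 * min 1 ((1 / a * x) ^ 2) := by positivity
  have h2 : 0 ≤ |u| * δ := by positivity
  have h3 : 0 ≤ 2 * min 1 ((1 / b * x) ^ 2) := by positivity
  rcases lt_or_ge |x| a with hxa | hxa
  · rw [hq0 x hxa, mul_zero, Real.cos_zero,
      abs_of_nonneg (by linarith [Real.cos_le_one (u * x)])]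
    have h4 : (1 / a * x) ^ 2 ≤ 1 := by
      rw [sq_le_one_iff_abs_le_one, abs_mul, abs_of_pos (by positivity : 0 < 1 / a),
        one_div_mul_eq_div, div_le_one ha]
      exact hxa.le
    have h5 := Real.one_sub_sq_div_two_le_cos (x := u * x)
    have h6 : u ^ 2 * a ^ 2 * (1 / a * x) ^ 2 = (u * x) ^ 2 := by field_simp
    rw [min_eq_right h4, h6]
    nlinarith [sq_nonneg (u * x)]
  rcases lt_or_ge |x| b with hxb | hxb
  · have h4 : |Real.cos (u * q x) - Real.cos (u * x)| ≤ |u * q x - u * x| :=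
      Real.abs_cos_sub_cos_le _ _
    rw [← mul_sub, abs_mul] at h4
    have h5 := mul_le_mul_of_nonneg_left (hqx x hxa hxb) (abs_nonneg u)
    linarith
  · have h4 : 1 ≤ (1 / b * x) ^ 2 := by
      rw [one_le_sq_iff_one_le_abs, abs_mul, abs_of_pos (by positivity : 0 < 1 / b),
        one_div_mul_eq_div, one_le_div hb]
      exact hxb
    rw [min_eq_left h4]
    have h5 : |Real.cos (u * q x) - Real.cos (u * x)| ≤ 2 := by
      rw [abs_le]
      constructor <;> linarith [Real.cos_le_one (u * q x), Real.cos_le_one (u * x),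
        Real.neg_one_le_cos (u * q x), Real.neg_one_le_cos (u * x)]
    linarith

end TruncatedMoment

/-! ### Comparison of characteristic functions for fixed `n` -/

section Comparison

theorem norm_prod_sub_prod_le {ι : Type*} (s : Finset ι) (a b : ι → ℂ) (ha : ∀ i ∈ s, ‖a i‖ ≤ 1)
    (hb : ∀ i ∈ s, ‖b i‖ ≤ 1) : ‖∏ i ∈ s, a i - ∏ i ∈ s, b i‖ ≤ ∑ i ∈ s, ‖a i - b i‖ := by
  classical
  induction s using Finset.induction_on with
  | empty => simp
  | insert j s hj ih =>
    rw [Finset.prod_insert hj, Finset.prod_insert hj, Finset.sum_insert hj]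
    have h1 := ih (fun i hi => ha i (Finset.mem_insert_of_mem hi))
      (fun i hi => hb i (Finset.mem_insert_of_mem hi))
    have h2 : ‖∏ i ∈ s, a i‖ ≤ 1 := by
      rw [norm_prod]
      exact Finset.prod_le_one (fun _ _ => norm_nonneg _)
        fun i hi => ha i (Finset.mem_insert_of_mem hi)
    have h3 : a j * ∏ i ∈ s, a i - b j * ∏ i ∈ s, b i
        = (a j - b j) * ∏ i ∈ s, a i + b j * (∏ i ∈ s, a i - ∏ i ∈ s, b i) := by ring
    rw [h3]
    refine (norm_add_le _ _).trans (add_le_add ?_ ?_)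
    · rw [norm_mul]
      exact mul_le_of_le_one_right (norm_nonneg _) h2
    · rw [norm_mul]
      exact (mul_le_of_le_one_left (norm_nonneg _) (hb j (Finset.mem_insert_self _ _))).trans h1

variable {X : Type*} [MeasurableSpace X] {m : Measure X}

theorem charFun_map_eq_integral {V : X → ℝ} (hV : AEMeasurable V m) (u : ℝ) :
    charFun (m.map V) u = ∫ x, Complex.exp (u * V x * Complex.I) ∂m := by
  rw [charFun_apply_real, integral_map hV (by fun_prop)]

variable [IsProbabilityMeasure m]

theorem integrable_exp_mul_I {V : X → ℝ} (hV : AEMeasurable V m) (u : ℝ) :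
    Integrable (fun x => Complex.exp (u * V x * Complex.I)) m := by
  refine Integrable.of_bound (by fun_prop) 1 (Eventually.of_forall fun x => ?_)
  rw [← Complex.ofReal_mul, Complex.norm_exp_ofReal_mul_I]

/-- If the characteristic function of `V` at `u` is close to `1`, then `exp (i u V)` is close to `1`
in `L¹`, because `|exp (i y) - 1|² = 2 - 2 cos y`. -/
theorem integral_norm_exp_sub_one_le {V : X → ℝ} (hV : AEMeasurable V m) {u a : ℝ} (ha : 0 < a)
    (h : ‖1 - charFun (m.map V) u‖ ≤ a) :
    ∫ x, ‖Complex.exp (u * V x * Complex.I) - 1‖ ∂m ≤ Real.sqrt (2 * a) := by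
  have hi := integrable_exp_mul_I hV u
  have hcos : Integrable (fun x => Real.cos (u * V x)) m := by
    refine Integrable.of_bound (by fun_prop) 1 (Eventually.of_forall fun x => ?_)
    exact Real.abs_cos_le_one _
  have hre : ∫ x, Real.cos (u * V x) ∂m = (charFun (m.map V) u).re := by
    rw [charFun_map_eq_integral hV]
    have h1 := integral_re (𝕜 := ℂ) hi
    simp only [RCLike.re_to_complex] at h1
    rw [← h1]
    refine integral_congr_ae (Eventually.of_forall fun x => ?_)
    simp only
    rw [← Complex.ofReal_mul, Complex.exp_ofReal_mul_I_re]
  have hle : 1 - ∫ x, Real.cos (u * V x) ∂m ≤ a := by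
    rw [hre]
    have h1 := Complex.re_le_norm (1 - charFun (m.map V) u)
    rw [Complex.sub_re, Complex.one_re] at h1
    exact h1.trans h
  set δ := Real.sqrt (2 * a) with hδ
  have hδ0 : 0 < δ := Real.sqrt_pos.2 (by linarith)
  have hδ2 : δ ^ 2 = 2 * a := Real.sq_sqrt (by linarith)
  -- The inequality `z ≤ δ / 2 + z² / (2 δ)`, for the value of `δ` that is optimal in the mean.
  have hpt : ∀ x, ‖Complex.exp (u * V x * Complex.I) - 1‖
      ≤ δ / 2 + (1 - Real.cos (u * V x)) / δ := by
    intro x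
    have h1 : ‖Complex.exp (u * V x * Complex.I) - 1‖ ^ 2 = 2 - 2 * Real.cos (u * V x) := by
      rw [← Complex.ofReal_mul, mul_comm, Complex.norm_exp_I_mul_ofReal_sub_one, Real.norm_eq_abs,
        sq_abs, mul_pow, Real.sin_sq_eq_half_sub, mul_div_cancel₀ _ (two_ne_zero)]
      ring
    have h2 : δ / 2 + (1 - Real.cos (u * V x)) / δ
        = (δ ^ 2 + ‖Complex.exp (u * V x * Complex.I) - 1‖ ^ 2) / (2 * δ) := by
      rw [h1]; field_simp
    rw [h2, le_div_iff₀ (by linarith)]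
    nlinarith [sq_nonneg (δ - ‖Complex.exp (u * V x * Complex.I) - 1‖)]
  have hint0 : Integrable (fun x => (1 - Real.cos (u * V x)) / δ) m :=
    ((integrable_const _).sub hcos).div_const _
  have hint : Integrable (fun x => δ / 2 + (1 - Real.cos (u * V x)) / δ) m :=
    (integrable_const _).add hint0
  calc _ ≤ ∫ x, (δ / 2 + (1 - Real.cos (u * V x)) / δ) ∂m :=
        integral_mono (hi.sub (integrable_const _)).norm hint hpt
    _ = δ / 2 + (1 - ∫ x, Real.cos (u * V x) ∂m) / δ := by
        have h1 : ∫ x, (1 - Real.cos (u * V x)) / δ ∂m = (1 - ∫ x, Real.cos (u * V x) ∂m) / δ := by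
          rw [integral_div, integral_sub (integrable_const _) hcos]
          simp
        rw [integral_add (integrable_const _) hint0, h1]
        simp
    _ ≤ δ / 2 + a / δ := by gcongr
    _ = δ := by
        have : a = δ ^ 2 / 2 := by linarith
        rw [this]; field_simp; ring

/-- Sums which agree up to two small terms `V` and `V'` outside of a small set have close
characteristic functions. -/
theorem norm_charFun_sub_le {S V V' W : X → ℝ} (hS : AEMeasurable S m) (hV : AEMeasurable V m)
    (hV' : AEMeasurable V' m) (hW : AEMeasurable W m) {B : Set X} (hB : MeasurableSet B)
    (hSB : ∀ x ∉ B, S x = V x - V' x + W x) (u : ℝ) :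
    ‖charFun (m.map S) u - charFun (m.map W) u‖
      ≤ ∫ x, ‖Complex.exp (u * V x * Complex.I) - 1‖ ∂m
        + ∫ x, ‖Complex.exp (u * V' x * Complex.I) - 1‖ ∂m + 2 * m.real B := by
  have hiS := integrable_exp_mul_I hS u
  have hiW := integrable_exp_mul_I hW u
  have hi1 : Integrable (fun x => ‖Complex.exp (u * V x * Complex.I) - 1‖) m :=
    ((integrable_exp_mul_I hV u).sub (integrable_const 1)).norm
  have hi2 : Integrable (fun x => ‖Complex.exp (u * V' x * Complex.I) - 1‖) m :=
    ((integrable_exp_mul_I hV' u).sub (integrable_const 1)).norm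
  have hi3 : Integrable (B.indicator fun _ => (2 : ℝ)) m := (integrable_const _).indicator hB
  rw [charFun_map_eq_integral hS, charFun_map_eq_integral hW, ← integral_sub hiS hiW]
  have hB2 : 2 * m.real B = ∫ x, B.indicator (fun _ => (2 : ℝ)) x ∂m := by
    rw [integral_indicator hB, setIntegral_const, smul_eq_mul, mul_comm]
  have hsum : ∫ x, ‖Complex.exp (u * V x * Complex.I) - 1‖ ∂m
        + ∫ x, ‖Complex.exp (u * V' x * Complex.I) - 1‖ ∂m + 2 * m.real B
      = ∫ x, (‖Complex.exp (u * V x * Complex.I) - 1‖ + ‖Complex.exp (u * V' x * Complex.I) - 1‖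
        + B.indicator (fun _ => (2 : ℝ)) x) ∂m := by
    rw [integral_add (f := fun x => ‖Complex.exp (u * V x * Complex.I) - 1‖
        + ‖Complex.exp (u * V' x * Complex.I) - 1‖) (hi1.add hi2) hi3, ← hB2]
    rw [integral_add (f := fun x => ‖Complex.exp (u * V x * Complex.I) - 1‖) hi1 hi2]
  rw [hsum]
  refine (norm_integral_le_integral_norm _).trans
    (integral_mono (hiS.sub hiW).norm ((hi1.add hi2).add hi3) fun x => ?_)
  simp only
  have hnorm : ∀ y : ℝ, ‖Complex.exp (u * y * Complex.I)‖ = 1 := fun y => by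
    rw [← Complex.ofReal_mul, Complex.norm_exp_ofReal_mul_I]
  by_cases hx : x ∈ B
  · rw [Set.indicator_of_mem hx]
    have h1 := norm_sub_le (Complex.exp (u * S x * Complex.I)) (Complex.exp (u * W x * Complex.I))
    rw [hnorm, hnorm] at h1
    have h2 := norm_nonneg (Complex.exp (u * V x * Complex.I) - 1)
    have h3 := norm_nonneg (Complex.exp (u * V' x * Complex.I) - 1)
    linarith
  · rw [Set.indicator_of_notMem hx, add_zero, hSB x hx]
    have h1 : Complex.exp (u * ((V x - V' x + W x : ℝ) : ℂ) * Complex.I)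
          - Complex.exp (u * W x * Complex.I)
        = (Complex.exp (u * V x * Complex.I) - Complex.exp (u * V' x * Complex.I))
          * Complex.exp (u * ((W x - V' x : ℝ) : ℂ) * Complex.I) := by
      rw [sub_mul, ← Complex.exp_add, ← Complex.exp_add]
      push_cast
      ring_nf
    rw [h1, norm_mul, hnorm, mul_one]
    have h2 := norm_sub_le (Complex.exp (u * V x * Complex.I) - 1)
      (Complex.exp (u * V' x * Complex.I) - 1)
    rwa [sub_sub_sub_cancel_right] at h2

end Comparison

section IndependentArray

variable {X : Type*} [MeasurableSpace X] {m : Measure X} {α : ℝ} {T : X → X} {f : ℕ → X → ℝ}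

/-- Characteristic function of a linear combination of finitely many entries of an independent
array `f_k ∘ T^j`. -/
theorem charFun_map_sum_array (hT : MeasurePreserving T m m)
    (hf : ∀ k, 1 ≤ k → Measurable (f k))
    (hind : iIndepFun (fun (p : ArrayIndex α) x => f p.1.1 (T^[p.1.2 - 1] x)) m)
    (s : Finset ℕ) (hs : ∀ k ∈ s, 1 ≤ k) (a : ℕ → ℕ → ℝ) (u : ℝ) :
    charFun (m.map fun x => ∑ k ∈ s, ∑ j ∈ Finset.range (2 * blockLen α k),
        a k j * f k (T^[j] x)) u
      = ∏ k ∈ s, ∏ j ∈ Finset.range (2 * blockLen α k), charFun (m.map (f k)) (a k j * u) := by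
  classical
  let r : Finset (ℕ × ℕ) := s.biUnion fun k =>
    (Finset.range (2 * blockLen α k)).image fun j => (k, j)
  have hr : ∀ p : ℕ × ℕ, p ∈ r ↔ p.1 ∈ s ∧ p.2 ∈ Finset.range (2 * blockLen α p.1) := by
    rintro ⟨k, j⟩
    simp only [r, Finset.mem_biUnion, Finset.mem_image, Prod.mk.injEq]
    constructor
    · rintro ⟨k', hk', j', hj', rfl, rfl⟩; exact ⟨hk', hj'⟩
    · rintro ⟨h1, h2⟩; exact ⟨k, h1, j, h2, rfl, rfl⟩
  let e : r → ArrayIndex α := fun p => ⟨(p.1.1, p.1.2 + 1), by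
    have h := (hr p.1).1 p.2
    have h1 := hs _ h.1
    have h2 := Finset.mem_range.1 h.2
    exact ⟨h1, by simp, h2⟩⟩
  have he : Function.Injective e := by
    rintro ⟨⟨k, j⟩, hp⟩ ⟨⟨k', j'⟩, hp'⟩ h
    simpa [e] using h
  have hTk : ∀ k : ℕ, Measurable T^[k] := fun k => hT.measurable.iterate k
  have h1 := (hind.precomp he).comp (fun (p : r) (y : ℝ) => a p.1.1 p.1.2 * y)
    fun p => measurable_const_mul _
  have hfm : ∀ p : r, Measurable (f p.1.1) := fun p => hf _ (hs _ ((hr p.1).1 p.2).1)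
  have h2 := iIndepFun.charFun_map_fun_sum_eq_prod (fun p =>
    (((hfm p).comp (hTk p.1.2)).const_mul (a p.1.1 p.1.2)).aemeasurable) h1
  have h3 : ∀ x, ∑ k ∈ s, ∑ j ∈ Finset.range (2 * blockLen α k), a k j * f k (T^[j] x)
      = ∑ p : r, a p.1.1 p.1.2 * f p.1.1 (T^[p.1.2] x) := by
    intro x
    rw [← Finset.sum_finset_product r s (fun k => Finset.range (2 * blockLen α k)) hr
      (f := fun p => a p.1 p.2 * f p.1 (T^[p.2] x))]
    exact (Finset.sum_coe_sort r fun p : ℕ × ℕ => a p.1 p.2 * f p.1 (T^[p.2] x)).symm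
  have h4 := congrFun h2 u
  simp only [Function.comp_def, Finset.prod_apply] at h4
  simp_rw [h3]
  rw [h4, ← Finset.prod_finset_product r s (fun k => Finset.range (2 * blockLen α k)) hr
      (f := fun p => charFun (m.map (f p.1)) (a p.1 p.2 * u)),
    ← Finset.prod_coe_sort r fun p : ℕ × ℕ => charFun (m.map (f p.1)) (a p.1 p.2 * u)]
  refine Finset.prod_congr rfl fun p _ => ?_
  have h5 : m.map (fun x => f p.1.1 (T^[p.1.2] x)) = m.map (f p.1.1) := by
    conv_rhs => rw [← (hT.iterate p.1.2).map_eq]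
    rw [Measure.map_map (hfm p) (hTk p.1.2)]
    rfl
  rw [← h5]
  exact charFun_map_mul_comp (((hfm p).comp (hTk p.1.2)).aemeasurable) _ _

end IndependentArray

/-! ### Estimates for a single row -/

section Row

variable {𝒳 Ω : Type*} [MeasurableSpace 𝒳] [MeasurableSpace Ω] {m : Measure 𝒳} {T : 𝒳 → 𝒳}
  {P : Measure Ω} {α : ℝ} {X : ℕ → ℕ → Ω → ℝ} {L : ℕ → ℕ} {t : ℕ → ℕ → ℝ} {f : ℕ → 𝒳 → ℝ}

theorem IsEmbedding.map_eq (hf : IsEmbedding α m T P (arrayZ L t X) f) (hX : IsStableArray α P X)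
    (hα0 : 0 < α) (hα2 : α < 2) {k : ℕ} (hk : 1 ≤ k) :
    m.map (f k) = (P.map (X k 0)).map (quantise L t k) := by
  have hd := blockLen_pos hα0 hα2 k
  have h := (hf.identDistrib.comp (measurable_pi_apply
    (⟨(k, 1), hk, le_rfl, by simp only; omega⟩ : ArrayIndex α))).map_eq
  rw [← map_arrayZ hX L t hk (by omega : 1 ≤ 2 * blockLen α k)]
  exact h

theorem IsStableArray.charFun_eq (hX : IsStableArray α P X) (hα0 : 0 < α) {k : ℕ} (hk : 1 ≤ k)
    (θ : ℝ) : charFun (P.map (X k 0)) θ = ((Real.exp (-(1 / k * |θ| ^ α)) : ℝ) : ℂ) := by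
  rw [(hX.law k 0 hk (Nat.zero_le _)).charFun_eq, ← Real.rpow_mul (Nat.cast_nonneg k),
    neg_mul, one_div_mul_cancel hα0.ne', Real.rpow_neg_one, one_div]

theorem one_div_two_pow_rpow (α : ℝ) (n : ℕ) : (1 / 2 ^ n : ℝ) ^ α = ((2 : ℝ) ^ (-α)) ^ n := by
  rw [one_div, Real.inv_rpow (by positivity), Real.rpow_neg two_pos.le, inv_pow,
    ← Real.rpow_natCast, ← Real.rpow_natCast, ← Real.rpow_mul two_pos.le,
    ← Real.rpow_mul two_pos.le, mul_comm]

theorem IsEmbedding.iIndepFun [IsProbabilityMeasure m] [IsProbabilityMeasure P]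
    (hf : IsEmbedding α m T P (arrayZ L t X) f)
    (hX : IsStableArray α P X) (hT : Measurable T) :
    iIndepFun (fun (p : ArrayIndex α) x => f p.1.1 (T^[p.1.2 - 1] x)) m := by
  have hm : ∀ p : ArrayIndex α, Measurable fun x => f p.1.1 (T^[p.1.2 - 1] x) := fun p =>
    (hf.measurable _ p.2.1).comp (hT.iterate _)
  have hZ : ∀ p : ArrayIndex α, Measurable (arrayZ L t X p.1.1 p.1.2) := fun p =>
    measurable_arrayZ hX L t p.2.1 p.2.2.2
  rw [iIndepFun_iff_map_fun_eq_infinitePi_map hm]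
  have h1 := (iIndepFun_iff_map_fun_eq_infinitePi_map hZ).1 (iIndepFun_arrayZ hX L t)
  have h2 : ∀ p : ArrayIndex α, m.map (fun x => f p.1.1 (T^[p.1.2 - 1] x))
      = P.map (arrayZ L t X p.1.1 p.1.2) := fun p =>
    (hf.identDistrib.comp (measurable_pi_apply p)).map_eq
  simp_rw [h2]
  rw [← h1]
  exact hf.identDistrib.map_eq

theorem measure_ne_zero_le [IsProbabilityMeasure P]
    (hf : IsEmbedding α m T P (arrayZ L t X) f) (hX : IsStableArray α P X)
    (ht : IsPartition α L t) (hα0 : 0 < α) (hα2 : α < 2) {k : ℕ} (hk : 1 ≤ k) :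
    m {x | f k x ≠ 0} ≤ ENNReal.ofReal (40 / k * ((2 : ℝ) ^ (-α)) ^ k) := by
  have := (hX.law k 0 hk (Nat.zero_le _)).isProbabilityMeasure
  have hq := measurable_quantise L t k
  have hms : MeasurableSet {y : ℝ | y ≠ 0} := (measurableSet_singleton 0).compl
  have h1 : m {x | f k x ≠ 0} = P.map (X k 0) {x | quantise L t k x ≠ 0} := by
    have h := congrArg (fun ν : Measure ℝ => ν {y | y ≠ 0}) (hf.map_eq hX hα0 hα2 hk)
    rw [Measure.map_apply (hf.measurable k hk) hms, Measure.map_apply hq hms] at h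
    exact h
  rw [h1, ← ofReal_measureReal]
  refine ENNReal.ofReal_le_ofReal ?_
  have h2 := measureReal_ne_zero_le (μ := P.map (X k 0)) hq (a := 2 ^ k) (by positivity)
    (fun x hx => quantise_eq_zero ht hk hx)
  have h3 := truncMoment_le (hX.charFun_eq hα0 hk) hα0 (by positivity)
    (by positivity : (0 : ℝ) ≤ 1 / 2 ^ k)
  rw [one_div_two_pow_rpow] at h3
  refine (h2.trans h3).trans (le_of_eq ?_)
  ring

/-- Each entry of row `k` is at scale `k^{-1/α}`, like the stable variable it is cut from. -/
theorem norm_one_sub_charFun_row_le (hf : IsEmbedding α m T P (arrayZ L t X) f)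
    (hX : IsStableArray α P X) (ht : IsPartition α L t) (hα0 : 0 < α) (hα2 : α < 2) {k : ℕ}
    (hk : 1 ≤ k) (u : ℝ) : ‖1 - charFun (m.map (f k)) u‖ ≤ 80 / k * |u| ^ α := by
  have := (hX.law k 0 hk (Nat.zero_le _)).isProbabilityMeasure
  rw [hf.map_eq hX hα0 hα2 hk]
  have h1 := norm_one_sub_charFun_map_le (hX.charFun_eq hα0 hk) (measurable_quantise L t k)
    (quantise_neg L t k) (abs_quantise_le ht hk) u
  have h2 := truncMoment_le (hX.charFun_eq hα0 hk) hα0 (by positivity) (abs_nonneg u)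
  have h3 : 80 / (k : ℝ) * |u| ^ α = 2 * (40 * (1 / k * |u| ^ α)) := by ring
  linarith

/-- Bound for the distance between the characteristic functions of `Z_k(1)` and `X_k(1)` at `u`. The
three terms account for the lower truncation, the discretisation and the upper truncation. -/
noncomputable def rowError (α : ℝ) (k : ℕ) (u : ℝ) : ℝ :=
  40 * u ^ 2 / k * (4 * (2 : ℝ) ^ (-α)) ^ k + |u| / blockLen α k
    + 80 / k * ((2 : ℝ) ^ (-α)) ^ (k ^ 2)

theorem norm_charFun_row_sub_le (hf : IsEmbedding α m T P (arrayZ L t X) f)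
    (hX : IsStableArray α P X) (ht : IsPartition α L t) (hα0 : 0 < α) (hα2 : α < 2) {k : ℕ}
    (hk : 1 ≤ k) (u : ℝ) :
    ‖charFun (m.map (f k)) u - ((Real.exp (-(1 / k * |u| ^ α)) : ℝ) : ℂ)‖ ≤ rowError α k u := by
  have := (hX.law k 0 hk (Nat.zero_le _)).isProbabilityMeasure
  rw [hf.map_eq hX hα0 hα2 hk, ← hX.charFun_eq hα0 hk]
  have h1 := norm_charFun_map_sub_le (hX.charFun_eq hα0 hk) (measurable_quantise L t k)
    (quantise_neg L t k) (a := 2 ^ k) (b := 2 ^ (k ^ 2)) (δ := 1 / blockLen α k)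
    (by positivity) (by positivity) (by positivity)
    (fun x hx => quantise_eq_zero ht hk hx) (fun x hx hx' => abs_quantise_sub_le ht hk hx hx') u
  have h2 := truncMoment_le (hX.charFun_eq hα0 hk) hα0 (by positivity)
    (by positivity : (0 : ℝ) ≤ 1 / 2 ^ k)
  have h3 := truncMoment_le (hX.charFun_eq hα0 hk) hα0 (by positivity)
    (by positivity : (0 : ℝ) ≤ 1 / 2 ^ (k ^ 2))
  rw [one_div_two_pow_rpow] at h2 h3
  refine h1.trans ?_
  have h4 := mul_le_mul_of_nonneg_left h2 (by positivity : (0 : ℝ) ≤ u ^ 2 * (2 ^ k) ^ 2)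
  have h5 : u ^ 2 * (2 ^ k) ^ 2 * (40 * (1 / (k : ℝ) * ((2 : ℝ) ^ (-α)) ^ k))
      = 40 * u ^ 2 / k * (4 * (2 : ℝ) ^ (-α)) ^ k := by
    rw [mul_pow, ← pow_mul, mul_comm k 2, pow_mul]; norm_num; ring
  have h6 : |u| * (1 / (blockLen α k : ℝ)) = |u| / blockLen α k := by ring
  have h7 : 80 / (k : ℝ) * ((2 : ℝ) ^ (-α)) ^ (k ^ 2)
      = 2 * (40 * (1 / k * ((2 : ℝ) ^ (-α)) ^ (k ^ 2))) := by ring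
  unfold rowError
  rw [h5] at h4
  rw [h6, h7]
  linarith

end Row

/-! ### Almost sure finiteness -/

section Finiteness

variable {𝒳 Ω : Type*} [MeasurableSpace 𝒳] [MeasurableSpace Ω] {m : Measure 𝒳} {T : 𝒳 → 𝒳}
  {P : Measure Ω} {α : ℝ} {X : ℕ → ℕ → Ω → ℝ} {L : ℕ → ℕ} {t : ℕ → ℕ → ℝ} {f : ℕ → 𝒳 → ℝ}

theorem measurable_term (hT : Measurable T) (hf : ∀ k, 1 ≤ k → Measurable (f k)) {k : ℕ}
    (hk : 1 ≤ k) : Measurable (term α T f k) :=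
  (hf k hk).sub ((hf k hk).comp (hT.iterate _))

theorem aemeasurable_cltFun (hT : Measurable T) (hf : ∀ k, 1 ≤ k → Measurable (f k))
    (hfin : ∀ᵐ x ∂m, {k : ℕ | 1 ≤ k ∧ term α T f k x ≠ 0}.Finite) :
    AEMeasurable (cltFun α T f) m := by
  refine aemeasurable_of_tendsto_metrizable_ae atTop
    (f := fun N x => ∑ k ∈ Finset.range N, term α T f (k + 1) x) (fun N => ?_) ?_
  · exact (Finset.measurable_sum _ fun k _ =>
      measurable_term hT hf (Nat.le_add_left 1 k)).aemeasurable
  · filter_upwards [hfin] with x hx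
    have hsupp : (Function.support fun k => term α T f (k + 1) x).Finite := by
      have h1 := hx.preimage ((add_left_injective 1).injOn (s := (fun k => k + 1) ⁻¹'
        {k : ℕ | 1 ≤ k ∧ term α T f k x ≠ 0}))
      exact h1.subset fun k hk => ⟨Nat.le_add_left 1 k, hk⟩
    exact (summable_of_hasFiniteSupport hsupp).hasSum.tendsto_sum_nat

theorem aemeasurable_birkhoffSum {g : 𝒳 → ℝ} (hT : MeasurePreserving T m m)
    (hg : AEMeasurable g m) (n : ℕ) : AEMeasurable (birkhoffSum T g n) m := by
  unfold birkhoffSum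
  exact Finset.aemeasurable_fun_sum _ fun i _ =>
    hg.comp_quasiMeasurePreserving (hT.iterate i).quasiMeasurePreserving

variable [IsProbabilityMeasure P]

theorem measure_term_ne_zero_le (hT : MeasurePreserving T m m)
    (hf : IsEmbedding α m T P (arrayZ L t X) f) (hX : IsStableArray α P X)
    (ht : IsPartition α L t) (hα0 : 0 < α) (hα2 : α < 2) {k : ℕ} (hk : 1 ≤ k) :
    m {x | term α T f k x ≠ 0} ≤ ENNReal.ofReal (80 / k * ((2 : ℝ) ^ (-α)) ^ k) := by
  have hms : MeasurableSet {x | f k x ≠ 0} :=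
    (hf.measurable k hk) (measurableSet_singleton 0).compl
  have h1 := measure_ne_zero_le hf hX ht hα0 hα2 hk
  have hsub : {x | term α T f k x ≠ 0}
      ⊆ {x | f k x ≠ 0} ∪ T^[blockLen α k] ⁻¹' {x | f k x ≠ 0} := by
    intro x hx
    by_contra hcon
    simp only [Set.mem_union, Set.mem_preimage, Set.mem_ofPred_eq, not_or, not_not] at hcon
    exact hx (by simp [term, hcon.1, hcon.2])
  refine (measure_mono hsub).trans ((measure_union_le _ _).trans ?_)
  rw [(hT.iterate _).measure_preimage hms.nullMeasurableSet]
  refine (add_le_add h1 h1).trans (le_of_eq ?_)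
  rw [← ENNReal.ofReal_add (by positivity) (by positivity)]
  congr 1
  ring

theorem rho_pos (α : ℝ) : 0 < (2 : ℝ) ^ (-α) := Real.rpow_pos_of_pos two_pos _

theorem rho_lt_one (hα0 : 0 < α) : (2 : ℝ) ^ (-α) < 1 :=
  Real.rpow_lt_one_of_one_lt_of_neg one_lt_two (neg_lt_zero.2 hα0)

/-- Borel-Cantelli: almost everywhere only finitely many terms are nonzero. -/
theorem ae_finite_term_ne_zero (hT : MeasurePreserving T m m)
    (hf : IsEmbedding α m T P (arrayZ L t X) f) (hX : IsStableArray α P X)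
    (ht : IsPartition α L t) (hα0 : 0 < α) (hα2 : α < 2) :
    ∀ᵐ x ∂m, {k : ℕ | 1 ≤ k ∧ term α T f k x ≠ 0}.Finite := by
  have hsum : ∑' k : ℕ, m {x | 1 ≤ k ∧ term α T f k x ≠ 0} ≠ ⊤ := by
    have hgeo : Summable fun k : ℕ => 80 * ((2 : ℝ) ^ (-α)) ^ k :=
      (summable_geometric_of_lt_one (rho_pos α).le (rho_lt_one hα0)).mul_left _
    refine ne_top_of_le_ne_top hgeo.tsum_ofReal_ne_top (ENNReal.tsum_le_tsum fun k => ?_)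
    rcases Nat.eq_zero_or_pos k with rfl | hk
    · simp
    · have h1 : {x | 1 ≤ k ∧ term α T f k x ≠ 0} = {x | term α T f k x ≠ 0} := by
        ext x
        simp only [Set.mem_ofPred_eq]
        exact ⟨fun h => h.2, fun h => ⟨hk, h⟩⟩
      rw [h1]
      refine (measure_term_ne_zero_le hT hf hX ht hα0 hα2 hk).trans (ENNReal.ofReal_le_ofReal ?_)
      have h2 : (1 : ℝ) ≤ k := by exact_mod_cast hk
      exact mul_le_mul_of_nonneg_right (div_le_self (by norm_num) h2)
        (pow_nonneg (rho_pos α).le k)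
  exact ae_finite_setOfPred_mem hsum

end Finiteness

/-! ### Decomposition of Birkhoff sums -/

section Decomposition

variable {𝒳 : Type*} {α : ℝ} {T : 𝒳 → 𝒳} {f : ℕ → 𝒳 → ℝ}

/-- Part of the Birkhoff sum coming from the short rows: the sum over the first half of each block
of row `k < J`. -/
noncomputable def shortRows (α : ℝ) (T : 𝒳 → 𝒳) (f : ℕ → 𝒳 → ℝ) (J : ℕ) (x : 𝒳) : ℝ :=
  ∑ k ∈ Finset.Ico 1 J, ∑ j ∈ Finset.range (2 * blockLen α k),
    (if j < blockLen α k then 1 else 0) * f k (T^[j] x)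

/-- Part of the Birkhoff sum coming from the rows `J ≤ k ≤ K`, whose half blocks are longer than
`n`. -/
noncomputable def longRows (α : ℝ) (T : 𝒳 → 𝒳) (f : ℕ → 𝒳 → ℝ) (n J K : ℕ) (x : 𝒳) : ℝ :=
  ∑ k ∈ Finset.Ico J (K + 1), ∑ j ∈ Finset.range (2 * blockLen α k),
    ((if j < n then 1 else 0) - (if blockLen α k ≤ j ∧ j < blockLen α k + n then 1 else 0))
      * f k (T^[j] x)

theorem sum_range_ite_lt (g : ℕ → ℝ) {a b : ℕ} (h : a ≤ b) :
    ∑ j ∈ Finset.range b, (if j < a then 1 else 0) * g j = ∑ j ∈ Finset.range a, g j := by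
  simp only [ite_mul, one_mul, zero_mul]
  rw [← Finset.sum_filter]
  refine Finset.sum_congr ?_ fun _ _ => rfl
  ext j
  simp only [Finset.mem_filter, Finset.mem_range]
  omega

theorem sum_range_ite_between (g : ℕ → ℝ) {a n b : ℕ} (h : a + n ≤ b) :
    ∑ j ∈ Finset.range b, (if a ≤ j ∧ j < a + n then 1 else 0) * g j
      = ∑ j ∈ Finset.range n, g (a + j) := by
  simp only [ite_mul, one_mul, zero_mul]
  rw [← Finset.sum_filter]
  have h1 : (Finset.range b).filter (fun j => a ≤ j ∧ j < a + n) = Finset.Ico a (a + n) := by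
    ext j
    simp only [Finset.mem_filter, Finset.mem_range, Finset.mem_Ico]
    omega
  rw [h1, Finset.sum_Ico_eq_sum_range, Nat.add_sub_cancel_left]

theorem sum_term_iterate (n k : ℕ) (x : 𝒳) :
    ∑ i ∈ Finset.range n, term α T f k (T^[i] x)
      = ∑ i ∈ Finset.range n, f k (T^[i] x)
        - ∑ i ∈ Finset.range n, f k (T^[blockLen α k + i] x) := by
  rw [← Finset.sum_sub_distrib]
  refine Finset.sum_congr rfl fun i _ => ?_
  rw [term, ← Function.iterate_add_apply]

/-- The sum of `f - f ∘ T^d` over `n` steps is the sum of `f - f ∘ T^n` over `d` steps. -/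
theorem sum_term_iterate' (n k : ℕ) (x : 𝒳) :
    ∑ i ∈ Finset.range n, term α T f k (T^[i] x)
      = ∑ i ∈ Finset.range (blockLen α k), f k (T^[i] x)
        - ∑ i ∈ Finset.range (blockLen α k), f k (T^[i] (T^[n] x)) := by
  have h1 : ∀ i, T^[i] (T^[n] x) = T^[n + i] x := fun i => by
    rw [← Function.iterate_add_apply, add_comm]
  simp_rw [h1]
  rw [sum_term_iterate, sub_eq_sub_iff_add_eq_add]
  have h2 := Finset.sum_range_add (fun i => f k (T^[i] x)) n (blockLen α k)
  have h3 := Finset.sum_range_add (fun i => f k (T^[i] x)) (blockLen α k) n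
  rw [add_comm (blockLen α k) n] at h3
  linarith

/-- Rewriting of the terms of a Birkhoff sum: the roles of `n` and `d_k` are exchanged in the rows
`k < J`, where `d_k` may be smaller than `n`, and the rows beyond `K` vanish. -/
theorem birkhoffSum_eq {n J K : ℕ} (hJ : 1 ≤ J) (hJK : J ≤ K + 1)
    (hd : ∀ k, J ≤ k → n ≤ blockLen α k) {x : 𝒳}
    (hx : ∀ k, K + 1 ≤ k → ∀ i < n, term α T f k (T^[i] x) = 0) :
    birkhoffSum T (cltFun α T f) n x
      = shortRows α T f J x - shortRows α T f J (T^[n] x) + longRows α T f n J K x := by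
  have h1 : ∀ i < n, cltFun α T f (T^[i] x)
      = ∑ k ∈ Finset.Ico 1 (K + 1), term α T f k (T^[i] x) := by
    intro i hi
    rw [cltFun, tsum_eq_sum (s := Finset.range K) fun k hk => hx (k + 1)
      (by rw [Finset.mem_range] at hk; omega) i hi, Finset.sum_Ico_eq_sum_range,
      Nat.add_sub_cancel]
    exact Finset.sum_congr rfl fun k _ => by rw [add_comm]
  rw [birkhoffSum, Finset.sum_congr rfl fun i hi => h1 i (Finset.mem_range.1 hi), Finset.sum_comm,
    ← Finset.sum_Ico_consecutive _ hJ hJK]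
  congr 1
  · rw [shortRows, shortRows, ← Finset.sum_sub_distrib]
    refine Finset.sum_congr rfl fun k _ => ?_
    rw [sum_term_iterate', sum_range_ite_lt _ (by omega), sum_range_ite_lt _ (by omega)]
  · rw [longRows]
    refine Finset.sum_congr rfl fun k hk => ?_
    have hdk := hd k (Finset.mem_Ico.1 hk).1
    simp_rw [sub_mul]
    rw [sum_term_iterate, Finset.sum_sub_distrib, sum_range_ite_lt _ (by omega),
      sum_range_ite_between _ (by omega)]

end Decomposition

/-! ### Characteristic functions of Birkhoff sums at a fixed time -/

section FixedTime

variable {𝒳 Ω : Type*} [MeasurableSpace 𝒳] [MeasurableSpace Ω] {m : Measure 𝒳}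
  [IsProbabilityMeasure m] {T : 𝒳 → 𝒳} {P : Measure Ω} [IsProbabilityMeasure P] {α : ℝ}
  {X : ℕ → ℕ → Ω → ℝ} {L : ℕ → ℕ} {t : ℕ → ℕ → ℝ} {f : ℕ → 𝒳 → ℝ}

theorem measurable_shortRows (hT : Measurable T) (hf : ∀ k, 1 ≤ k → Measurable (f k)) (J : ℕ) :
    Measurable (shortRows α T f J) := by
  unfold shortRows
  refine Finset.measurable_fun_sum _ fun k hk => Finset.measurable_fun_sum _ fun j _ => ?_
  exact ((hf k (Finset.mem_Ico.1 hk).1).comp (hT.iterate j)).const_mul _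

theorem measurable_longRows (hT : Measurable T) (hf : ∀ k, 1 ≤ k → Measurable (f k)) (n : ℕ)
    {J : ℕ} (hJ : 1 ≤ J) (K : ℕ) : Measurable (longRows α T f n J K) := by
  unfold longRows
  refine Finset.measurable_fun_sum _ fun k hk => Finset.measurable_fun_sum _ fun j _ => ?_
  exact ((hf k (hJ.trans (Finset.mem_Ico.1 hk).1)).comp (hT.iterate j)).const_mul _

theorem norm_one_sub_charFun_shortRows_le (hT : MeasurePreserving T m m)
    (hf : IsEmbedding α m T P (arrayZ L t X) f) (hX : IsStableArray α P X)
    (ht : IsPartition α L t) (hα0 : 0 < α) (hα2 : α < 2) (J : ℕ) (u : ℝ) :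
    ‖1 - charFun (m.map (shortRows α T f J)) u‖
      ≤ ∑ k ∈ Finset.Ico 1 J, blockLen α k * (80 / k * |u| ^ α) := by
  have h0 : charFun (m.map (shortRows α T f J)) u
      = ∏ k ∈ Finset.Ico 1 J, ∏ j ∈ Finset.range (2 * blockLen α k),
        charFun (m.map (f k)) ((if j < blockLen α k then 1 else 0) * u) :=
    charFun_map_sum_array hT hf.measurable (hf.iIndepFun hX hT.measurable) _
      (fun k hk => (Finset.mem_Ico.1 hk).1) (fun k j => if j < blockLen α k then 1 else 0) u
  have hprob : ∀ k ∈ Finset.Ico 1 J, IsProbabilityMeasure (m.map (f k)) := fun k hk =>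
    Measure.isProbabilityMeasure_map (hf.measurable k (Finset.mem_Ico.1 hk).1).aemeasurable
  have hc : ∀ k ∈ Finset.Ico 1 J, ∀ v, ‖charFun (m.map (f k)) v‖ ≤ 1 := fun k hk v => by
    have := hprob k hk
    exact norm_charFun_le_one v
  have h1 := norm_prod_sub_prod_le (Finset.Ico 1 J)
    (fun k => ∏ j ∈ Finset.range (2 * blockLen α k),
        charFun (m.map (f k)) ((if j < blockLen α k then 1 else 0) * u)) (fun _ => 1)
    (fun k hk => by
      rw [norm_prod]
      exact Finset.prod_le_one (fun _ _ => norm_nonneg _) fun _ _ => hc k hk _)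
    (fun _ _ => by simp)
  rw [← h0, Finset.prod_const_one, norm_sub_rev] at h1
  refine h1.trans (Finset.sum_le_sum fun k hk => ?_)
  have := hprob k hk
  have h2 := norm_prod_sub_prod_le (Finset.range (2 * blockLen α k))
    (fun j => charFun (m.map (f k)) ((if j < blockLen α k then 1 else 0) * u)) (fun _ => 1)
    (fun _ _ => hc k hk _) (fun _ _ => by simp)
  rw [Finset.prod_const_one] at h2
  have h3 : ∀ j ∈ Finset.range (2 * blockLen α k),
      ‖charFun (m.map (f k)) ((if j < blockLen α k then 1 else 0) * u) - 1‖
        ≤ (if j < blockLen α k then 1 else 0) * (80 / k * |u| ^ α) := by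
    intro j _
    split_ifs
    · rw [one_mul, one_mul, norm_sub_rev]
      exact norm_one_sub_charFun_row_le hf hX ht hα0 hα2 (Finset.mem_Ico.1 hk).1 u
    · simp
  refine h2.trans ((Finset.sum_le_sum h3).trans (le_of_eq ?_))
  rw [sum_range_ite_lt (fun _ => 80 / (k : ℝ) * |u| ^ α) (by omega)]
  simp

theorem rowError_neg (k : ℕ) (u : ℝ) : rowError α k (-u) = rowError α k u := by
  simp [rowError]

/-- The long rows contribute, up to an error, the product of `2n` stable characteristic functions
for every row. -/
theorem norm_charFun_longRows_sub_le (hT : MeasurePreserving T m m)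
    (hf : IsEmbedding α m T P (arrayZ L t X) f) (hX : IsStableArray α P X)
    (ht : IsPartition α L t) (hα0 : 0 < α) (hα2 : α < 2) {n J K : ℕ} (hJ : 1 ≤ J)
    (hd : ∀ k, J ≤ k → n ≤ blockLen α k) (u : ℝ) :
    ‖charFun (m.map (longRows α T f n J K)) u
        - ((Real.exp (-(2 * (n * |u| ^ α) * ∑ k ∈ Finset.Ico J (K + 1), 1 / (k : ℝ))) : ℝ) : ℂ)‖
      ≤ ∑ k ∈ Finset.Ico J (K + 1), 2 * n * rowError α k u := by
  let A : ℕ → ℕ → ℝ := fun k j =>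
    (if j < n then 1 else 0) - (if blockLen α k ≤ j ∧ j < blockLen α k + n then 1 else 0)
  let w : ℕ → ℕ → ℝ := fun k j =>
    (if j < n then 1 else 0) + (if blockLen α k ≤ j ∧ j < blockLen α k + n then 1 else 0)
  have h1k : ∀ k ∈ Finset.Ico J (K + 1), 1 ≤ k := fun k hk => hJ.trans (Finset.mem_Ico.1 hk).1
  have hw : ∀ k ∈ Finset.Ico J (K + 1), ∀ c : ℝ,
      ∑ j ∈ Finset.range (2 * blockLen α k), w k j * c = 2 * n * c := by
    intro k hk c
    have hdk := hd k (Finset.mem_Ico.1 hk).1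
    simp only [w, add_mul]
    rw [Finset.sum_add_distrib, sum_range_ite_lt (fun _ => c) (by omega),
      sum_range_ite_between (fun _ => c) (by omega)]
    simp
    ring
  have h0 : charFun (m.map (longRows α T f n J K)) u
      = ∏ k ∈ Finset.Ico J (K + 1), ∏ j ∈ Finset.range (2 * blockLen α k),
        charFun (m.map (f k)) (A k j * u) :=
    charFun_map_sum_array hT hf.measurable (hf.iIndepFun hX hT.measurable) _ h1k A u
  have hexp : ((Real.exp (-(2 * (n * |u| ^ α)
        * ∑ k ∈ Finset.Ico J (K + 1), 1 / (k : ℝ))) : ℝ) : ℂ)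
      = ∏ k ∈ Finset.Ico J (K + 1), ∏ j ∈ Finset.range (2 * blockLen α k),
        ((Real.exp (-(w k j * (1 / k * |u| ^ α))) : ℝ) : ℂ) := by
    simp_rw [← Complex.ofReal_prod, ← Real.exp_sum, Finset.sum_neg_distrib]
    rw [Finset.sum_congr rfl fun k hk => hw k hk _, Finset.mul_sum]
    congr 3
    exact Finset.sum_congr rfl fun k _ => by ring
  have hc : ∀ k ∈ Finset.Ico J (K + 1), ∀ v, ‖charFun (m.map (f k)) v‖ ≤ 1 := fun k hk v => by
    have : IsProbabilityMeasure (m.map (f k)) :=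
      Measure.isProbabilityMeasure_map (hf.measurable k (h1k k hk)).aemeasurable
    exact norm_charFun_le_one v
  have he : ∀ k j, ‖((Real.exp (-(w k j * (1 / k * |u| ^ α))) : ℝ) : ℂ)‖ ≤ 1 := by
    intro k j
    rw [Complex.norm_real, Real.norm_eq_abs, Real.abs_exp]
    refine Real.exp_le_one_iff.2 (neg_nonpos.2 (mul_nonneg ?_ (by positivity)))
    simp only [w]
    split_ifs <;> norm_num
  rw [h0, hexp]
  refine (norm_prod_sub_prod_le _ _ _ (fun k hk => ?_) (fun k _ => ?_)).trans
    (Finset.sum_le_sum fun k hk => ?_)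
  · rw [norm_prod]
    exact Finset.prod_le_one (fun _ _ => norm_nonneg _) fun _ _ => hc k hk _
  · rw [norm_prod]
    exact Finset.prod_le_one (fun _ _ => norm_nonneg _) fun _ _ => he k _
  · have hdk := hd k (Finset.mem_Ico.1 hk).1
    refine (norm_prod_sub_prod_le _ _ _ (fun j _ => hc k hk _) (fun j _ => he k j)).trans ?_
    rw [← hw k hk]
    refine Finset.sum_le_sum fun j _ => ?_
    have hrow := norm_charFun_row_sub_le hf hX ht hα0 hα2 (h1k k hk)
    by_cases hj1 : j < n
    · have hA : A k j = 1 := by simp only [A]; rw [if_pos hj1, if_neg (by omega)]; norm_num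
      have hW : w k j = 1 := by simp only [w]; rw [if_pos hj1, if_neg (by omega)]; norm_num
      rw [hA, hW, one_mul, one_mul, one_mul]
      exact hrow u
    · by_cases hj2 : blockLen α k ≤ j ∧ j < blockLen α k + n
      · have hA : A k j = -1 := by simp only [A]; rw [if_neg hj1, if_pos hj2]; norm_num
        have hW : w k j = 1 := by simp only [w]; rw [if_neg hj1, if_pos hj2]; norm_num
        rw [hA, hW, neg_one_mul, one_mul, one_mul, ← rowError_neg, ← abs_neg u]
        exact hrow (-u)
      · have hA : A k j = 0 := by simp only [A]; rw [if_neg hj1, if_neg hj2]; norm_num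
        have hW : w k j = 0 := by simp only [w]; rw [if_neg hj1, if_neg hj2]; norm_num
        have : IsProbabilityMeasure (m.map (f k)) :=
          Measure.isProbabilityMeasure_map (hf.measurable k (h1k k hk)).aemeasurable
        rw [hA, hW]
        simp

/-- The set on which a row beyond `K` contributes to the Birkhoff sum up to time `n`. -/
def lateSet (α : ℝ) (T : 𝒳 → 𝒳) (f : ℕ → 𝒳 → ℝ) (n K : ℕ) : Set 𝒳 :=
  ⋃ k : ℕ, ⋃ i ∈ Finset.range n, T^[i] ⁻¹' {x | term α T f (K + 1 + k) x ≠ 0}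

theorem measurableSet_lateSet (hT : Measurable T) (hf : ∀ k, 1 ≤ k → Measurable (f k))
    (n K : ℕ) : MeasurableSet (lateSet α T f n K) := by
  refine MeasurableSet.iUnion fun k => Finset.measurableSet_biUnion _ fun i _ => ?_
  exact (hT.iterate i) ((measurable_term hT hf (by omega)) (measurableSet_singleton 0).compl)

omit [IsProbabilityMeasure m] in
theorem measureReal_lateSet_le (hT : MeasurePreserving T m m)
    (hf : IsEmbedding α m T P (arrayZ L t X) f) (hX : IsStableArray α P X)
    (ht : IsPartition α L t) (hα0 : 0 < α) (hα2 : α < 2) (n K : ℕ) :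
    m.real (lateSet α T f n K)
      ≤ n * (80 / (K + 1) * ((2 : ℝ) ^ (-α)) ^ (K + 1)) * (1 - (2 : ℝ) ^ (-α))⁻¹ := by
  set ρ : ℝ := (2 : ℝ) ^ (-α) with hρ
  have hρ0 : 0 < ρ := rho_pos α
  have hρ1 : ρ < 1 := rho_lt_one hα0
  have hgeo := summable_geometric_of_lt_one hρ0.le hρ1
  have h1 : ∀ k : ℕ, m {x | term α T f (K + 1 + k) x ≠ 0}
      ≤ ENNReal.ofReal (80 / (K + 1) * ρ ^ (K + 1) * ρ ^ k) := by
    intro k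
    refine (measure_term_ne_zero_le hT hf hX ht hα0 hα2 (by omega)).trans
      (ENNReal.ofReal_le_ofReal ?_)
    rw [← hρ, pow_add, mul_assoc]
    refine mul_le_mul_of_nonneg_right ?_ (by positivity)
    refine div_le_div_of_nonneg_left (by norm_num) (by positivity) ?_
    push_cast
    linarith [(Nat.cast_nonneg k : (0 : ℝ) ≤ k)]
  have h2 : m (lateSet α T f n K)
      ≤ ENNReal.ofReal (n * (80 / (K + 1) * ρ ^ (K + 1)) * (1 - ρ)⁻¹) := by
    calc m (lateSet α T f n K)
        ≤ ∑' k : ℕ, ∑ i ∈ Finset.range n, m (T^[i] ⁻¹' {x | term α T f (K + 1 + k) x ≠ 0}) :=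
          (measure_iUnion_le _).trans (ENNReal.tsum_le_tsum fun k =>
            measure_biUnion_finset_le _ _)
      _ ≤ ∑' k : ℕ, ENNReal.ofReal (n * (80 / (K + 1) * ρ ^ (K + 1)) * ρ ^ k) := by
          refine ENNReal.tsum_le_tsum fun k => ?_
          have h3 : ∀ i, m (T^[i] ⁻¹' {x | term α T f (K + 1 + k) x ≠ 0})
              = m {x | term α T f (K + 1 + k) x ≠ 0} := fun i =>
            (hT.iterate i).measure_preimage ((measurable_term hT.measurable hf.measurable
              (by omega)) (measurableSet_singleton 0).compl).nullMeasurableSet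
          simp_rw [h3]
          rw [Finset.sum_const, Finset.card_range, nsmul_eq_mul, mul_assoc,
            ENNReal.ofReal_mul (Nat.cast_nonneg n), ENNReal.ofReal_natCast]
          gcongr
          exact h1 k
      _ = _ := by
          rw [← ENNReal.ofReal_tsum_of_nonneg (fun k => by positivity) (hgeo.mul_left _),
            tsum_mul_left, tsum_geometric_of_lt_one hρ0.le hρ1]
  refine ENNReal.toReal_le_of_le_ofReal ?_ h2
  have : 0 < 1 - ρ := by linarith
  positivity

/-- Comparison of the characteristic function of the Birkhoff sum with a stable one. The three error
terms come from the short rows, the late rows, and the approximation in the long rows. -/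
theorem norm_charFun_birkhoffSum_sub_le (hT : MeasurePreserving T m m)
    (hf : IsEmbedding α m T P (arrayZ L t X) f) (hX : IsStableArray α P X)
    (ht : IsPartition α L t) (hα0 : 0 < α) (hα2 : α < 2) {n J K : ℕ} (hJ : 1 ≤ J)
    (hJK : J ≤ K + 1) (hd : ∀ k, J ≤ k → n ≤ blockLen α k) (u : ℝ) {a : ℝ} (ha : 0 < a)
    (hsum : ∑ k ∈ Finset.Ico 1 J, blockLen α k * (80 / k * |u| ^ α) ≤ a) :
    ‖charFun (m.map (birkhoffSum T (cltFun α T f) n)) u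
        - ((Real.exp (-(2 * (n * |u| ^ α) * ∑ k ∈ Finset.Ico J (K + 1), 1 / (k : ℝ))) : ℝ) : ℂ)‖
      ≤ 2 * Real.sqrt (2 * a)
        + 2 * (n * (80 / (K + 1) * ((2 : ℝ) ^ (-α)) ^ (K + 1)) * (1 - (2 : ℝ) ^ (-α))⁻¹)
        + ∑ k ∈ Finset.Ico J (K + 1), 2 * n * rowError α k u := by
  have hTm := hT.measurable
  have hV := measurable_shortRows (α := α) hTm hf.measurable J
  have hV' : Measurable fun x => shortRows α T f J (T^[n] x) := hV.comp (hTm.iterate n)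
  have hW := measurable_longRows (α := α) hTm hf.measurable n hJ K
  have hfin := ae_finite_term_ne_zero hT hf hX ht hα0 hα2
  have hS := aemeasurable_birkhoffSum hT (aemeasurable_cltFun hTm hf.measurable hfin) n
  have hB := measurableSet_lateSet (α := α) hTm hf.measurable n K
  have hSB : ∀ x ∉ lateSet α T f n K, birkhoffSum T (cltFun α T f) n x
      = shortRows α T f J x - shortRows α T f J (T^[n] x) + longRows α T f n J K x := by
    intro x hx
    refine birkhoffSum_eq hJ hJK hd fun k hk i hi => ?_
    by_contra hne
    refine hx ?_
    simp only [lateSet, Set.mem_iUnion]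
    exact ⟨k - (K + 1), i, Finset.mem_range.2 hi, by
      rw [Set.mem_preimage, Set.mem_ofPred_eq, Nat.add_sub_cancel' hk]; exact hne⟩
  have h1 := norm_charFun_sub_le hS hV.aemeasurable hV'.aemeasurable hW.aemeasurable hB hSB u
  have h2 := (norm_one_sub_charFun_shortRows_le hT hf hX ht hα0 hα2 J u).trans hsum
  have h3 := integral_norm_exp_sub_one_le hV.aemeasurable ha h2
  have hmap : m.map (fun x => shortRows α T f J (T^[n] x)) = m.map (shortRows α T f J) := by
    have h5 := Measure.map_map (μ := m) hV (hTm.iterate n)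
    rw [(hT.iterate n).map_eq] at h5
    exact h5.symm
  have h4 := integral_norm_exp_sub_one_le (u := u) hV'.aemeasurable ha (by rw [hmap]; exact h2)
  have h5 := measureReal_lateSet_le hT hf hX ht hα0 hα2 n K
  have h6 := norm_charFun_longRows_sub_le (K := K) hT hf hX ht hα0 hα2 hJ hd u
  refine (norm_sub_le_norm_sub_add_norm_sub _ (charFun (m.map (longRows α T f n J K)) u) _).trans ?_
  linarith

end FixedTime

/-! ### The rows that matter at time `n` -/

section Asymptotics

/-- `∑_{k ≤ N} r^k / k` is dominated by its last terms, so it is `o(r^N)`. -/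
theorem tendsto_geom_sum_div {r : ℝ} (hr : 1 < r) :
    Tendsto (fun N : ℕ => ∑ k ∈ Finset.range N, r ^ (k + 1) / ((k : ℝ) + 1) / r ^ N) atTop
      (𝓝 0) := by
  have hr0 : 0 < r := by linarith
  let F : ℕ → ℕ → ℝ := fun N j => if j < N then (r⁻¹) ^ j / ((N : ℝ) - j) else 0
  have h1 : ∀ N, ∑ k ∈ Finset.range N, r ^ (k + 1) / ((k : ℝ) + 1) / r ^ N = ∑' j, F N j := by
    intro N
    rw [tsum_eq_sum (f := F N) (s := Finset.range N) fun j hj => if_neg (mt Finset.mem_range.2 hj),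
      ← Finset.sum_range_reflect]
    refine Finset.sum_congr rfl fun j hj => ?_
    have hj' := Finset.mem_range.1 hj
    simp only [F]
    rw [if_pos hj', show N - 1 - j + 1 = N - j by omega,
      show ((N - 1 - j : ℕ) : ℝ) + 1 = (N : ℝ) - j by
        rw [← Nat.cast_add_one, show N - 1 - j + 1 = N - j by omega, Nat.cast_sub hj'.le],
      div_right_comm]
    congr 1
    rw [pow_sub₀ _ hr0.ne' hj'.le, inv_pow]
    field_simp
  simp_rw [h1]
  rw [← tsum_zero (α := ℝ) (β := ℕ)]
  refine tendsto_tsum_of_dominated_convergence (bound := fun j => (r⁻¹) ^ j)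
    (summable_geometric_of_lt_one (by positivity) (inv_lt_one_of_one_lt₀ hr)) (fun j => ?_) ?_
  · have h2 : Tendsto (fun N : ℕ => (r⁻¹) ^ j / ((N : ℝ) - j)) atTop (𝓝 0) :=
      tendsto_const_nhds.div_atTop
        (tendsto_atTop_add_const_right _ (-(j : ℝ)) tendsto_natCast_atTop_atTop)
    refine h2.congr' ?_
    filter_upwards [eventually_gt_atTop j] with N hN
    exact (if_pos hN).symm
  · refine Eventually.of_forall fun N j => ?_
    simp only [F]
    split_ifs with h
    · have h3 : (1 : ℝ) ≤ (N : ℝ) - j := by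
        have : (j : ℝ) + 1 ≤ N := by exact_mod_cast h
        linarith
      rw [Real.norm_eq_abs, abs_of_nonneg (by positivity)]
      exact div_le_self (by positivity) h3
    · rw [norm_zero]; positivity

theorem summable_pow_mul_pow_sq {r ρ : ℝ} (hr : 0 < r) (hρ : 0 < ρ) (hρ1 : ρ < 1) :
    Summable fun k : ℕ => r ^ k * ρ ^ (k ^ 2) := by
  refine summable_of_ratio_test_tendsto_lt_one zero_lt_one
    (Eventually.of_forall fun k => by positivity) ?_
  have h1 : ∀ k : ℕ, ‖r ^ (k + 1) * ρ ^ ((k + 1) ^ 2)‖ / ‖r ^ k * ρ ^ (k ^ 2)‖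
      = r * ρ * (ρ ^ 2) ^ k := by
    intro k
    rw [Real.norm_of_nonneg (by positivity), Real.norm_of_nonneg (by positivity),
      div_eq_iff (by positivity)]
    ring
  simp_rw [h1]
  have h2 := (tendsto_pow_atTop_nhds_zero_of_lt_one (r := ρ ^ 2) (by positivity)
    (by nlinarith)).const_mul (r * ρ)
  rwa [mul_zero] at h2

/-- If `a n / b n → c > 0` for sequences tending to infinity, then
`∑_{b n < k ≤ a n} 1 / k → log c`. -/
theorem tendsto_harmonic_sub_harmonic {a b : ℕ → ℕ} (ha : Tendsto a atTop atTop)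
    (hb : Tendsto b atTop atTop) {c : ℝ} (hc : 0 < c)
    (hab : Tendsto (fun n => (a n : ℝ) / b n) atTop (𝓝 c)) :
    Tendsto (fun n => ((harmonic (a n) : ℚ) : ℝ) - ((harmonic (b n) : ℚ) : ℝ)) atTop
      (𝓝 (Real.log c)) := by
  have h1 := (Real.tendsto_harmonic_sub_log.comp ha).sub (Real.tendsto_harmonic_sub_log.comp hb)
  have h2 := ((Real.continuousAt_log hc.ne').tendsto.comp hab).add h1
  rw [sub_self, add_zero] at h2
  refine h2.congr' ?_
  filter_upwards [ha.eventually_gt_atTop 0, hb.eventually_gt_atTop 0] with n h3 h4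
  have h5 : (a n : ℝ) ≠ 0 := by exact_mod_cast h3.ne'
  have h6 : (b n : ℝ) ≠ 0 := by exact_mod_cast h4.ne'
  simp only [Function.comp_apply]
  rw [Real.log_div h5 h6]
  ring

/-- The first row whose half block length `d_k` is at least `n`. -/
noncomputable def firstRow (α : ℝ) (n : ℕ) : ℕ := ⌈(2 - α) / (2 * α) * Real.logb 2 n⌉₊

/-- The last row `k` whose lower truncation level satisfies `2^k ≤ n^{1/α}`. -/
noncomputable def lastRow (α : ℝ) (n : ℕ) : ℕ := ⌊1 / α * Real.logb 2 n⌋₊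

variable {α : ℝ}

theorem logb_natCast_pos {n : ℕ} (hn : 2 ≤ n) : 0 < Real.logb 2 n :=
  Real.logb_pos one_lt_two (by exact_mod_cast hn)

theorem two_rpow_logb_natCast {n : ℕ} (hn : 2 ≤ n) : (2 : ℝ) ^ Real.logb 2 n = n :=
  Real.rpow_logb two_pos (by norm_num) (by positivity)

theorem one_le_firstRow (hα0 : 0 < α) (hα2 : α < 2) {n : ℕ} (hn : 2 ≤ n) :
    1 ≤ firstRow α n :=
  Nat.ceil_pos.2 (mul_pos (div_pos (by linarith) (by linarith)) (logb_natCast_pos hn))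

theorem firstRow_le (hα0 : 0 < α) {n : ℕ} (hn : 2 ≤ n) :
    firstRow α n ≤ lastRow α n + 1 := by
  refine Nat.ceil_le.2 ?_
  have h1 := Nat.lt_floor_add_one (1 / α * Real.logb 2 n)
  have h2 : (2 - α) / (2 * α) ≤ 1 / α := by
    rw [div_le_div_iff₀ (by linarith) hα0]
    nlinarith
  have h3 := mul_le_mul_of_nonneg_right h2 (logb_natCast_pos hn).le
  push_cast
  exact (h3.trans_lt h1).le

theorem le_blockLen (hα0 : 0 < α) (hα2 : α < 2) {n k : ℕ} (hn : 2 ≤ n)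
    (hk : firstRow α n ≤ k) : n ≤ blockLen α k := by
  have h1 : (2 - α) / (2 * α) * Real.logb 2 n ≤ k := Nat.ceil_le.1 hk
  refine Nat.le_floor ?_
  rw [← two_rpow_logb_natCast hn]
  refine Real.rpow_le_rpow_of_exponent_le one_le_two ?_
  have h2 : 0 < 2 - α := by linarith
  rw [div_mul_eq_mul_div, div_le_iff₀ (by linarith)] at h1
  rw [le_div_iff₀ h2]
  linarith

theorem blockLen_le (k : ℕ) :
    (blockLen α k : ℝ) ≤ ((2 : ℝ) ^ (2 * α / (2 - α))) ^ k := by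
  refine (Nat.floor_le (by positivity)).trans (le_of_eq ?_)
  rw [← Real.rpow_natCast, ← Real.rpow_mul two_pos.le]
  congr 1
  ring

theorem pow_firstRow_le (hα0 : 0 < α) (hα2 : α < 2) {n : ℕ} (hn : 2 ≤ n) :
    ((2 : ℝ) ^ (2 * α / (2 - α))) ^ (firstRow α n - 1) ≤ n := by
  have h2 : 0 < 2 - α := by linarith
  have hl := logb_natCast_pos hn
  have h1 : (firstRow α n : ℝ) < (2 - α) / (2 * α) * Real.logb 2 n + 1 :=
    Nat.ceil_lt_add_one (mul_nonneg (div_nonneg h2.le (by linarith)) hl.le)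
  rw [← Real.rpow_natCast, ← Real.rpow_mul two_pos.le]
  conv_rhs => rw [← two_rpow_logb_natCast hn]
  refine Real.rpow_le_rpow_of_exponent_le one_le_two ?_
  rw [Nat.cast_sub (one_le_firstRow hα0 hα2 hn), Nat.cast_one]
  calc 2 * α / (2 - α) * ((firstRow α n : ℝ) - 1)
      ≤ 2 * α / (2 - α) * ((2 - α) / (2 * α) * Real.logb 2 n) :=
        mul_le_mul_of_nonneg_left (by linarith) (div_nonneg (by linarith) h2.le)
    _ = Real.logb 2 n := by field_simp

theorem two_pow_lastRow_le (hα0 : 0 < α) {n : ℕ} (hn : 2 ≤ n) :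
    (2 : ℝ) ^ lastRow α n ≤ (n : ℝ) ^ (1 / α) := by
  have hl := logb_natCast_pos hn
  conv_rhs => rw [← two_rpow_logb_natCast hn]
  rw [← Real.rpow_natCast, ← Real.rpow_mul two_pos.le, mul_comm]
  exact Real.rpow_le_rpow_of_exponent_le one_le_two (Nat.floor_le (by positivity))

theorem natCast_mul_pow_lastRow_le (hα0 : 0 < α) {n : ℕ} (hn : 2 ≤ n) :
    n * ((2 : ℝ) ^ (-α)) ^ (lastRow α n + 1) ≤ 1 := by
  conv_lhs => rw [← two_rpow_logb_natCast hn]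
  rw [← Real.rpow_natCast, ← Real.rpow_mul two_pos.le, ← Real.rpow_add two_pos]
  refine Real.rpow_le_one_of_one_le_of_nonpos one_le_two ?_
  have h1 := Nat.lt_floor_add_one (1 / α * Real.logb 2 n)
  rw [one_div_mul_eq_div, div_lt_iff₀ hα0] at h1
  simp only [lastRow, one_div_mul_eq_div]
  push_cast
  linarith

theorem tendsto_logb_natCast : Tendsto (fun n : ℕ => Real.logb 2 n) atTop atTop :=
  (Real.tendsto_logb_atTop one_lt_two).comp tendsto_natCast_atTop_atTop

theorem tendsto_lastRow (hα0 : 0 < α) : Tendsto (lastRow α) atTop atTop :=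
  tendsto_nat_floor_atTop.comp (tendsto_logb_natCast.const_mul_atTop (by positivity))

theorem tendsto_firstRow (hα0 : 0 < α) (hα2 : α < 2) : Tendsto (firstRow α) atTop atTop :=
  tendsto_nat_ceil_atTop.comp
    (tendsto_logb_natCast.const_mul_atTop (div_pos (by linarith) (by linarith)))

theorem tendsto_firstRow_sub_one (hα0 : 0 < α) (hα2 : α < 2) :
    Tendsto (fun n => firstRow α n - 1) atTop atTop :=
  (tendsto_sub_atTop_nat 1).comp (tendsto_firstRow hα0 hα2)

/-- The ratio of the last and the first relevant rows tends to `2 / (2 - α)`; this is where the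
logarithm in the scale of the limit comes from. -/
theorem tendsto_sum_one_div (hα0 : 0 < α) (hα2 : α < 2) :
    Tendsto (fun n => ∑ k ∈ Finset.Ico (firstRow α n) (lastRow α n + 1), 1 / (k : ℝ)) atTop
      (𝓝 (Real.log (2 / (2 - α)))) := by
  have h2 : 0 < 2 - α := by linarith
  have hc : 0 < (2 - α) / (2 * α) := div_pos h2 (by linarith)
  have hK : Tendsto (fun n => (lastRow α n : ℝ) / Real.logb 2 n) atTop (𝓝 (1 / α)) :=
    (tendsto_nat_floor_mul_div_atTop (by positivity)).comp tendsto_logb_natCast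
  have hJ : Tendsto (fun n => (firstRow α n : ℝ) / Real.logb 2 n) atTop
      (𝓝 ((2 - α) / (2 * α))) :=
    (tendsto_nat_ceil_mul_div_atTop hc.le).comp tendsto_logb_natCast
  have hJ1 := hJ.sub tendsto_logb_natCast.inv_tendsto_atTop
  rw [sub_zero] at hJ1
  have hratio : Tendsto (fun n => (lastRow α n : ℝ) / ((firstRow α n - 1 : ℕ) : ℝ)) atTop
      (𝓝 (2 / (2 - α))) := by
    have h3 := hK.div hJ1 hc.ne'
    have h4 : 1 / α / ((2 - α) / (2 * α)) = 2 / (2 - α) := by field_simp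
    rw [h4] at h3
    refine h3.congr' ?_
    filter_upwards [eventually_ge_atTop 2] with n hn
    have hl := (logb_natCast_pos hn).ne'
    simp only [Pi.div_apply, Pi.inv_apply]
    rw [Nat.cast_sub (one_le_firstRow hα0 hα2 hn), Nat.cast_one, inv_eq_one_div, ← sub_div,
      div_div_div_cancel_right₀ hl]
  refine (tendsto_harmonic_sub_harmonic (tendsto_lastRow hα0) (tendsto_firstRow_sub_one hα0 hα2)
    (div_pos two_pos h2) hratio).congr' ?_
  filter_upwards [eventually_ge_atTop 2] with n hn
  have hJ' := one_le_firstRow hα0 hα2 hn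
  have h5 : ∀ N : ℕ, ((harmonic N : ℚ) : ℝ) = ∑ k ∈ Finset.Ico 1 (N + 1), 1 / (k : ℝ) := by
    intro N
    rw [harmonic_eq_sum_Icc]
    push_cast
    simp_rw [one_div]
    rfl
  rw [h5, h5, Nat.sub_add_cancel hJ',
    ← Finset.sum_Ico_consecutive _ hJ' (firstRow_le hα0 hn), add_sub_cancel_left]

theorem sum_Ico_one_eq_sum_range (g : ℕ → ℝ) (N : ℕ) :
    ∑ k ∈ Finset.Ico 1 (N + 1), g k = ∑ k ∈ Finset.range N, g (k + 1) := by
  rw [Finset.sum_Ico_eq_sum_range, Nat.add_sub_cancel]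
  exact Finset.sum_congr rfl fun k _ => by rw [add_comm]

/-- Bound for the short rows: they have total scale `o(n)`. -/
theorem sum_shortRows_le (hα0 : 0 < α) (hα2 : α < 2) {n : ℕ} (hn : 2 ≤ n) {c : ℝ} (hc : 0 ≤ c) :
    ∑ k ∈ Finset.Ico 1 (firstRow α n), blockLen α k * (80 / k * (c / n))
      ≤ 80 * c * ∑ k ∈ Finset.range (firstRow α n - 1),
          ((2 : ℝ) ^ (2 * α / (2 - α))) ^ (k + 1) / ((k : ℝ) + 1)
            / ((2 : ℝ) ^ (2 * α / (2 - α))) ^ (firstRow α n - 1) := by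
  have hJ := one_le_firstRow hα0 hα2 hn
  have hp := pow_firstRow_le hα0 hα2 hn
  set r : ℝ := (2 : ℝ) ^ (2 * α / (2 - α)) with hr
  have hr0 : 0 < r := by positivity
  have hn0 : (0 : ℝ) < n := by positivity
  obtain ⟨N, hN⟩ : ∃ N, firstRow α n = N + 1 := ⟨firstRow α n - 1, by omega⟩
  rw [hN, Nat.add_sub_cancel] at hp ⊢
  rw [sum_Ico_one_eq_sum_range, Finset.mul_sum]
  refine Finset.sum_le_sum fun k _ => ?_
  have h1 := blockLen_le (α := α) (k + 1)
  calc (blockLen α (k + 1) : ℝ) * (80 / ((k + 1 : ℕ) : ℝ) * (c / n))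
      ≤ r ^ (k + 1) * (80 / ((k + 1 : ℕ) : ℝ) * (c / r ^ N)) := by gcongr
    _ = _ := by push_cast; ring

theorem four_mul_two_rpow_neg (α : ℝ) : 4 * (2 : ℝ) ^ (-α) = (2 : ℝ) ^ (2 - α) := by
  rw [sub_eq_add_neg, Real.rpow_add two_pos, Real.rpow_two]
  norm_num

/-- With `y = n^{1/α} ≥ 2^K` this is `y^α (2^K)^{2-α} ≤ y^2`. -/
theorem natCast_mul_sq_div_rpow_le (hα0 : 0 < α) (hα2 : α < 2) {n : ℕ} (hn : 2 ≤ n) (θ : ℝ) :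
    n * (θ / (n : ℝ) ^ (1 / α)) ^ 2 ≤ θ ^ 2 / (4 * (2 : ℝ) ^ (-α)) ^ lastRow α n := by
  have hy := two_pow_lastRow_le hα0 hn
  have hn0 : (0 : ℝ) < n := by positivity
  have hyn : ((n : ℝ) ^ (1 / α)) ^ α = n := by
    rw [← Real.rpow_mul hn0.le, one_div_mul_cancel hα0.ne', Real.rpow_one]
  set y : ℝ := (n : ℝ) ^ (1 / α)
  have hy0 : 0 < y := by positivity
  have h1 : (4 * (2 : ℝ) ^ (-α)) ^ lastRow α n = ((2 : ℝ) ^ lastRow α n) ^ (2 - α) := by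
    rw [four_mul_two_rpow_neg, ← Real.rpow_natCast, ← Real.rpow_natCast, ← Real.rpow_mul two_pos.le,
      ← Real.rpow_mul two_pos.le, mul_comm]
  have h3 : n * (4 * (2 : ℝ) ^ (-α)) ^ lastRow α n ≤ y ^ 2 := by
    rw [h1, ← hyn]
    calc y ^ α * ((2 : ℝ) ^ lastRow α n) ^ (2 - α) ≤ y ^ α * y ^ (2 - α) := by
          gcongr
      _ = y ^ 2 := by
          rw [← Real.rpow_add hy0, add_sub_cancel, Real.rpow_two]
  rw [div_pow, le_div_iff₀ (by positivity), ← mul_div_assoc, div_mul_eq_mul_div,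
    div_le_iff₀ (by positivity)]
  nlinarith [mul_le_mul_of_nonneg_left h3 (sq_nonneg θ)]

/-- Bound for the approximation errors in the long rows. The lower truncation gives the first term,
the discretisation the second one and the upper truncation the third one. -/
theorem sum_rowError_le (hα0 : 0 < α) (hα2 : α < 2) {n : ℕ} (hn : 2 ≤ n) (θ : ℝ) :
    ∑ k ∈ Finset.Ico (firstRow α n) (lastRow α n + 1),
        2 * n * rowError α k (θ / (n : ℝ) ^ (1 / α))
      ≤ 80 * θ ^ 2 * (∑ k ∈ Finset.range (lastRow α n),
          (4 * (2 : ℝ) ^ (-α)) ^ (k + 1) / ((k : ℝ) + 1) / (4 * (2 : ℝ) ^ (-α)) ^ (lastRow α n))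
        + 2 * |θ| * (((lastRow α n : ℝ) + 1) * (1 / 2) ^ (lastRow α n))
        + 160 * ∑' k, (((2 : ℝ) ^ (2 * α / (2 - α))) ^ (k + firstRow α n)
            * ((2 : ℝ) ^ (-α)) ^ ((k + firstRow α n) ^ 2)) := by
  have hJ := one_le_firstRow hα0 hα2 hn
  have hy := two_pow_lastRow_le hα0 hn
  have hu := natCast_mul_sq_div_rpow_le hα0 hα2 hn θ
  have hd : ∀ k, firstRow α n ≤ k → n ≤ blockLen α k := fun k hk => le_blockLen hα0 hα2 hn hk
  have hρ0 := rho_pos α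
  have hρ1 := rho_lt_one hα0
  have hn0 : (0 : ℝ) < n := by positivity
  have habs : |θ / (n : ℝ) ^ (1 / α)| ≤ |θ| * (1 / 2) ^ lastRow α n := by
    rw [abs_div, abs_of_pos (by positivity : (0 : ℝ) < (n : ℝ) ^ (1 / α)), one_div_pow,
      mul_one_div]
    gcongr
  set u := θ / (n : ℝ) ^ (1 / α)
  set ρ : ℝ := (2 : ℝ) ^ (-α)
  set r : ℝ := (2 : ℝ) ^ (2 * α / (2 - α)) with hr
  set J := firstRow α n
  set K := lastRow α n
  have hr0 : 0 < r := by positivity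
  have h1 : ∀ k ∈ Finset.Ico J (K + 1), 2 * n * rowError α k u
      ≤ 80 * θ ^ 2 * ((4 * ρ) ^ k / k / (4 * ρ) ^ K) + 2 * |θ| * (1 / 2) ^ K
        + 160 * (r ^ k * ρ ^ (k ^ 2)) := by
    intro k hk
    have hJk := (Finset.mem_Ico.1 hk).1
    have hk1 : (1 : ℝ) ≤ k := by exact_mod_cast hJ.trans hJk
    have hdk : (n : ℝ) ≤ blockLen α k := by exact_mod_cast hd k hJk
    have hA : 2 * n * (40 * u ^ 2 / k * (4 * ρ) ^ k)
        ≤ 80 * θ ^ 2 * ((4 * ρ) ^ k / k / (4 * ρ) ^ K) := by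
      calc 2 * n * (40 * u ^ 2 / k * (4 * ρ) ^ k) = 80 * (n * u ^ 2) * ((4 * ρ) ^ k / k) := by ring
        _ ≤ 80 * (θ ^ 2 / (4 * ρ) ^ K) * ((4 * ρ) ^ k / k) := by gcongr
        _ = _ := by ring
    have hB : 2 * n * (|u| / blockLen α k) ≤ 2 * |θ| * (1 / 2) ^ K := by
      have h2 : n * (|u| / blockLen α k) ≤ |u| := by
        rw [← mul_div_assoc, div_le_iff₀ (hn0.trans_le hdk), mul_comm]
        gcongr
      linarith
    have hC : 2 * n * (80 / k * ρ ^ (k ^ 2)) ≤ 160 * (r ^ k * ρ ^ (k ^ 2)) := by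
      calc 2 * n * (80 / k * ρ ^ (k ^ 2)) ≤ 2 * r ^ k * (80 / 1 * ρ ^ (k ^ 2)) := by
            gcongr
            exact hdk.trans (blockLen_le k)
        _ = _ := by ring
    unfold rowError
    linarith
  refine (Finset.sum_le_sum h1).trans ?_
  rw [Finset.sum_add_distrib, Finset.sum_add_distrib, ← Finset.mul_sum, ← Finset.mul_sum,
    ← Finset.mul_sum, Finset.sum_const, Nat.card_Ico, nsmul_eq_mul]
  refine add_le_add (add_le_add ?_ ?_) ?_
  · have h2 := sum_Ico_one_eq_sum_range (fun k : ℕ => (4 * ρ) ^ k / (k : ℝ) / (4 * ρ) ^ K) K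
    push_cast at h2
    rw [← h2]
    refine mul_le_mul_of_nonneg_left ?_ (by positivity)
    exact Finset.sum_le_sum_of_subset_of_nonneg (Finset.Ico_subset_Ico_left hJ)
      fun k _ _ => by positivity
  · have h2 : ((K + 1 - J : ℕ) : ℝ) ≤ K + 1 := by exact_mod_cast Nat.sub_le _ _
    gcongr
  · refine mul_le_mul_of_nonneg_left ?_ (by norm_num)
    have hsum := (summable_nat_add_iff J).2 (summable_pow_mul_pow_sq hr0 hρ0 hρ1)
    have h2 := hsum.sum_le_tsum (Finset.range (K + 1 - J)) fun k _ => by positivity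
    refine le_trans (le_of_eq ?_) h2
    rw [Finset.sum_Ico_eq_sum_range]
    exact Finset.sum_congr rfl fun k _ => by rw [add_comm J]

end Asymptotics

/-! ### The stable limit theorem -/

section Limit

variable {𝒳 Ω : Type*} [MeasurableSpace 𝒳] [MeasurableSpace Ω] {m : Measure 𝒳}
  [IsProbabilityMeasure m] {T : 𝒳 → 𝒳} {P : Measure Ω} [IsProbabilityMeasure P] {α : ℝ}
  {X : ℕ → ℕ → Ω → ℝ} {L : ℕ → ℕ} {t : ℕ → ℕ → ℝ} {f : ℕ → 𝒳 → ℝ}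

theorem abs_div_rpow_rpow (hα0 : 0 < α) {n : ℕ} (hn : 2 ≤ n) (θ : ℝ) :
    |θ / (n : ℝ) ^ (1 / α)| ^ α = |θ| ^ α / n := by
  have hn0 : (0 : ℝ) < n := by positivity
  rw [abs_div, abs_of_pos (by positivity : (0 : ℝ) < (n : ℝ) ^ (1 / α)),
    Real.div_rpow (abs_nonneg θ) (by positivity), ← Real.rpow_mul hn0.le,
    one_div_mul_cancel hα0.ne', Real.rpow_one]

/-- Pointwise convergence of the characteristic functions of `S_n(f) / n^{1/α}`. -/
theorem tendsto_charFun_birkhoffSum (hT : MeasurePreserving T m m)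
    (hf : IsEmbedding α m T P (arrayZ L t X) f) (hX : IsStableArray α P X)
    (ht : IsPartition α L t) (hα0 : 0 < α) (hα2 : α < 2) (θ : ℝ) :
    Tendsto (fun n : ℕ => charFun (m.map (birkhoffSum T (cltFun α T f) n))
        (θ / (n : ℝ) ^ (1 / α))) atTop
      (𝓝 ((Real.exp (-(2 * Real.log (2 / (2 - α)) * |θ| ^ α)) : ℝ) : ℂ)) := by
  have h2α : 0 < 2 - α := by linarith
  have hρ0 := rho_pos α
  have hρ1 := rho_lt_one hα0
  set ρ : ℝ := (2 : ℝ) ^ (-α) with hρ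
  set r : ℝ := (2 : ℝ) ^ (2 * α / (2 - α)) with hr
  have hr1 : 1 < r := Real.one_lt_rpow one_lt_two (div_pos (by linarith) h2α)
  have hs1 : 1 < 4 * ρ := by
    rw [hρ, four_mul_two_rpow_neg]
    exact Real.one_lt_rpow one_lt_two h2α
  have hJ := tendsto_firstRow hα0 hα2
  have hK := tendsto_lastRow hα0
  let a : ℕ → ℝ := fun n => 80 * |θ| ^ α * ∑ k ∈ Finset.range (firstRow α n - 1),
    r ^ (k + 1) / ((k : ℝ) + 1) / r ^ (firstRow α n - 1)
  -- The summand `1 / n` only serves to make the error of the short rows positive.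
  have ha : Tendsto (fun n => 2 * Real.sqrt (2 * (a n + 1 / n))) atTop (𝓝 0) := by
    have h1 := (((tendsto_geom_sum_div hr1).comp (tendsto_firstRow_sub_one hα0 hα2)).const_mul
      (80 * |θ| ^ α)).add tendsto_one_div_atTop_nhds_zero_nat
    have h2 := ((h1.const_mul 2).sqrt).const_mul 2
    simpa using h2
  have hb : Tendsto (fun n => 2 * (80 / ((lastRow α n : ℝ) + 1) * (1 - ρ)⁻¹)) atTop (𝓝 0) := by
    have h1 : Tendsto (fun n => 80 / ((lastRow α n : ℝ) + 1)) atTop (𝓝 0) :=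
      tendsto_const_nhds.div_atTop (tendsto_atTop_add_const_right _ 1
        (tendsto_natCast_atTop_atTop.comp hK))
    simpa using (h1.mul_const (1 - ρ)⁻¹).const_mul 2
  have hc : Tendsto (fun n => 80 * θ ^ 2 * (∑ k ∈ Finset.range (lastRow α n),
      (4 * ρ) ^ (k + 1) / ((k : ℝ) + 1) / (4 * ρ) ^ (lastRow α n))) atTop (𝓝 0) := by
    simpa using ((tendsto_geom_sum_div hs1).comp hK).const_mul (80 * θ ^ 2)
  have hd : Tendsto (fun n => 2 * |θ| * (((lastRow α n : ℝ) + 1) * (1 / 2) ^ (lastRow α n))) atTop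
      (𝓝 0) := by
    have h1 : Tendsto (fun N : ℕ => ((N : ℝ) + 1) * (1 / 2 : ℝ) ^ N) atTop (𝓝 0) := by
      have h2 := (tendsto_self_mul_const_pow_of_lt_one (r := (1 / 2 : ℝ)) (by norm_num)
        (by norm_num)).add (tendsto_pow_atTop_nhds_zero_of_lt_one (r := (1 / 2 : ℝ)) (by norm_num)
        (by norm_num))
      rw [add_zero] at h2
      refine h2.congr fun N => ?_
      ring
    simpa using (h1.comp hK).const_mul (2 * |θ|)
  have he : Tendsto (fun n => 160 * ∑' k, (r ^ (k + firstRow α n)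
      * ρ ^ ((k + firstRow α n) ^ 2))) atTop (𝓝 0) := by
    have h1 := (tendsto_sum_nat_add fun k : ℕ => r ^ k * ρ ^ (k ^ 2)).comp hJ
    simpa using h1.const_mul 160
  have herr := (ha.add hb).add ((hc.add hd).add he)
  simp only [add_zero] at herr
  have hmain : Tendsto (fun n => ((Real.exp (-(2 * |θ| ^ α
      * ∑ k ∈ Finset.Ico (firstRow α n) (lastRow α n + 1), 1 / (k : ℝ))) : ℝ) : ℂ)) atTop
      (𝓝 ((Real.exp (-(2 * Real.log (2 / (2 - α)) * |θ| ^ α)) : ℝ) : ℂ)) := by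
    have h1 := ((tendsto_sum_one_div hα0 hα2).const_mul (2 * |θ| ^ α)).neg
    have h2 := (Complex.continuous_ofReal.tendsto _).comp ((Real.continuous_exp.tendsto _).comp h1)
    rw [show 2 * Real.log (2 / (2 - α)) * |θ| ^ α = 2 * |θ| ^ α * Real.log (2 / (2 - α)) by ring]
    exact h2
  have hdiff : Tendsto (fun n : ℕ => charFun (m.map (birkhoffSum T (cltFun α T f) n))
        (θ / (n : ℝ) ^ (1 / α)) - ((Real.exp (-(2 * |θ| ^ α
      * ∑ k ∈ Finset.Ico (firstRow α n) (lastRow α n + 1), 1 / (k : ℝ))) : ℝ) : ℂ)) atTop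
      (𝓝 0) := by
    refine squeeze_zero_norm' ?_ herr
    filter_upwards [eventually_ge_atTop 2] with n hn
    have hn0 : (0 : ℝ) < n := by positivity
    have hu := abs_div_rpow_rpow hα0 hn θ
    have h1 := sum_shortRows_le hα0 hα2 hn (c := |θ| ^ α) (by positivity)
    have h2 := sum_rowError_le hα0 hα2 hn θ
    have ha0 : 0 ≤ a n := by positivity
    have h3 := norm_charFun_birkhoffSum_sub_le hT hf hX ht hα0 hα2
      (one_le_firstRow hα0 hα2 hn) (firstRow_le hα0 hn) (fun k hk => le_blockLen hα0 hα2 hn hk)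
      (θ / (n : ℝ) ^ (1 / α)) (a := a n + 1 / n) (by positivity)
      (by rw [hu]; exact h1.trans (le_add_of_nonneg_right (by positivity)))
    rw [hu, mul_div_cancel₀ _ hn0.ne'] at h3
    have h4 : n * (80 / ((lastRow α n : ℝ) + 1) * ρ ^ (lastRow α n + 1)) * (1 - ρ)⁻¹
        ≤ 80 / ((lastRow α n : ℝ) + 1) * (1 - ρ)⁻¹ := by
      have h5 := natCast_mul_pow_lastRow_le hα0 hn
      have h6 : 0 < 1 - ρ := by linarith
      calc n * (80 / ((lastRow α n : ℝ) + 1) * ρ ^ (lastRow α n + 1)) * (1 - ρ)⁻¹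
          = 80 / ((lastRow α n : ℝ) + 1) * (1 - ρ)⁻¹ * (n * ρ ^ (lastRow α n + 1)) := by ring
        _ ≤ 80 / ((lastRow α n : ℝ) + 1) * (1 - ρ)⁻¹ * 1 := by gcongr
        _ = _ := mul_one _
    refine h3.trans ?_
    linarith
  have h := hdiff.add hmain
  simpa using h

/-- A scaled copy of the first row of the array has the required limit law. -/
theorem isSAS_map_mul (hX : IsStableArray α P X) {σ : ℝ} (hσ : 0 < σ) :
    IsSAS α σ (P.map fun ω => σ * X 1 0 ω) := by
  have hm : AEMeasurable (X 1 0) P := (hX.measurable 1 0 le_rfl (Nat.zero_le _)).aemeasurable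
  refine ⟨Measure.isProbabilityMeasure_map (hm.const_mul σ), hσ, fun θ => ?_⟩
  rw [charFun_map_mul_comp hm, (hX.law 1 0 le_rfl (Nat.zero_le _)).charFun_eq]
  simp only [Nat.cast_one, Real.one_rpow, one_mul]
  rw [abs_mul, abs_of_pos hσ, Real.mul_rpow hσ.le (abs_nonneg θ)]

end Limit

end StableCLT

theorem theorem1 {𝒳 Ω : Type*} [MeasurableSpace 𝒳] [StandardBorelSpace 𝒳] [MeasurableSpace Ω]
    (m : Measure 𝒳) [IsProbabilityMeasure m] (T : 𝒳 → 𝒳) (hT : Ergodic T m)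
    (hap : StableCLT.Aperiodic T m)
    (P : Measure Ω) [IsProbabilityMeasure P]
    (α : ℝ) (hα0 : 0 < α) (hα2 : α < 2)
    (X : ℕ → ℕ → Ω → ℝ) (hX : StableCLT.IsStableArray α P X)
    (L : ℕ → ℕ) (t : ℕ → ℕ → ℝ) (ht : StableCLT.IsPartition α L t) :
    (∃ f : ℕ → 𝒳 → ℝ, StableCLT.IsEmbedding α m T P (StableCLT.arrayZ L t X) f) ∧
    ∀ f : ℕ → 𝒳 → ℝ, StableCLT.IsEmbedding α m T P (StableCLT.arrayZ L t X) f →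
      (∀ᵐ x ∂m, {k : ℕ | 1 ≤ k ∧ StableCLT.term α T f k x ≠ 0}.Finite) ∧
      ∃ σ : ℝ, 0 < σ ∧ σ ^ α = 2 * Real.log (2 / (2 - α)) ∧
        ∃ ν : ProbabilityMeasure ℝ, StableCLT.IsSAS α σ (ν : Measure ℝ) ∧
          TendstoInDistribution
            (fun (n : ℕ) (x : 𝒳) =>
              birkhoffSum T (StableCLT.cltFun α T f) n x / (n : ℝ) ^ (1 / α))
            atTop (id : ℝ → ℝ) (fun _ => m) (ν : Measure ℝ) := by
  have hT' := hT.toMeasurePreserving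
  refine ⟨StableCLT.exists_isEmbedding hT hap hα0 hα2 hX L t, fun f hf => ?_⟩
  have hfin := StableCLT.ae_finite_term_ne_zero hT' hf hX ht hα0 hα2
  have hlog : 0 < 2 * Real.log (2 / (2 - α)) :=
    mul_pos two_pos (Real.log_pos (by rw [one_lt_div (by linarith)]; linarith))
  have hσ : 0 < (2 * Real.log (2 / (2 - α))) ^ (1 / α) := Real.rpow_pos_of_pos hlog _
  have hσα : ((2 * Real.log (2 / (2 - α))) ^ (1 / α)) ^ α = 2 * Real.log (2 / (2 - α)) := by
    rw [← Real.rpow_mul hlog.le, one_div_mul_cancel hα0.ne', Real.rpow_one]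
  have hμ := StableCLT.isSAS_map_mul hX hσ
  obtain ⟨ν, hν⟩ : ∃ ν : ProbabilityMeasure ℝ, StableCLT.IsSAS α _ (ν : Measure ℝ) :=
    ⟨⟨_, hμ.isProbabilityMeasure⟩, hμ⟩
  have hS : ∀ n, AEMeasurable (birkhoffSum T (StableCLT.cltFun α T f) n) m := fun n =>
    StableCLT.aemeasurable_birkhoffSum hT'
      (StableCLT.aemeasurable_cltFun hT.measurable hf.measurable hfin) n
  refine ⟨hfin, _, hσ, hσα, ν, hν, ?_⟩
  refine ⟨fun n => (hS n).div_const _, aemeasurable_id, ?_⟩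
  refine ProbabilityMeasure.tendsto_iff_tendsto_charFun.2 fun θ => ?_
  have h := StableCLT.tendsto_charFun_birkhoffSum hT' hf hX ht hα0 hα2 θ
  simp only [ProbabilityMeasure.coe_mk, Measure.map_id]
  rw [hν.charFun_eq, hσα]
  refine h.congr fun n => ?_
  simp_rw [div_eq_inv_mul]
  rw [charFun_map_mul_comp (hS n)]
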